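/- Let $M$ be a smooth three-dimensional manifold (for instance $\mathbb{R}^3$) with an oriented contact sub-Riemannian surface $\mathcal S=(\Delta,\langle\cdot,\cdot\rangle)$: $\Delta$ is a smooth oriented field of tangent planes such that $[X_1,X_2](p)\notin\Delta_p$ at every point $p$ whenever the smooth vector fields $X_1,X_2$ locally generate $\Delta$, and $\langle\cdot,\cdot\rangle$ is a smooth scalar product on the planes. A coframe $(\eta^1,\eta^2,\eta^3)$ at $p$ is adapted if $(\eta^1|_{\Delta_p},\eta^2|_{\Delta_p})$ is a positively oriented coframe of $\Delta_p$, $\eta^3|_{\Delta_p}=0$, and $\langle W,W\rangle=\eta^1(W)^2+\eta^2(W)^2$ for $W\in\Delta_p$. Let $B_0$ be the bundle of adapted coframes. Let $G_0$ be the group of the matrices $$\begin{pmatrix}\cos\varphi_1&-\sin\varphi_1&\varphi_2\\ \sin\varphi_1&\cos\varphi_1&\varphi_3\\0&0&\varphi_4\end{pmatrix},\quad \varphi_4\neq0,$$ let $G_1\subset G_0$ be given by $\varphi_4=1$ and $G_2\subset G_1$ by $\varphi_2=\varphi_3=0$, $\varphi_4=1$ (rotations), with Lie algebras $\mathfrak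 g_0,\mathfrak g_1,\mathfrak g_2$; they act on coframes, written as columns, by $R_g\eta=g^{-1}\eta$. A bundle of coframes is a $G$-structure if it has smooth local sections and $G$ acts simply transitively on each fibre. For a smooth local section $\eta$ of $B_k$ over an open set $U$, i.e. a coframe field $\eta=(\eta^1,\eta^2,\eta^3)$ on $U$ (the pullback of the tautological forms of $B_k$), consider the structure equations $$d\eta^i=\omega^i_s\wedge\eta^s+T^i_{23}\,\eta^2\wedge\eta^3+T^i_{31}\,\eta^3\wedge\eta^1+T^i_{12}\,\eta^1\wedge\eta^2$$ with a smooth $\mathfrak g_k$-valued connection form $\omega$ and smooth torsion coefficients $T$; the matrix $T(p)$ is then called a torsion matrix at the coframe $\eta_p$. Then: 1. $B_0$ is a $G_0$-structure. Torsion matrices exist at each $b\in B_0$, the coefficient $T^3_{12}(b)$ does not depend on the choice of section and connection, $T^3_{12}(b)\ne0$, and $T^3_{12}(R_gb)=\varphi_4^{-1}T^3_{12}(b)$ for $g\in G_0$. The subbundle $B_1=\{b\in B_0: T^3_{12}(b)=1\}$ is a $G_1$-structure. 2. On $B_1$ torsion matrices (for $\mathfrak g_1$-valued connections) exist, and $T^3_{23}$,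 $T^3_{31}$ do not depend on the choices, while $T^3_{12}=1$. The subbundle $B_2=\{b\in B_1: T^3_{23}(b)=T^3_{31}(b)=0\}$ is a $G_2$-structure. 3. Every local section $\eta$ of $B_2$ satisfies structure equations with a connection form $\begin{pmatrix}0&\alpha&0\\-\alpha&0&0\\0&0&0\end{pmatrix}$. If $\alpha$ is any such form, with torsion $T$, then replacing $\alpha$ by $\alpha'=\alpha+T^1_{12}\eta^1+T^2_{12}\eta^2-\tfrac12(T^2_{31}+T^1_{23})\eta^3$ brings the torsion matrix to the normal form $$\begin{pmatrix}a_1&a_2&0\\a_2&-a_1&0\\0&0&1\end{pmatrix},\qquad a_1=\tfrac12\,(T^1_{23}-T^2_{31}),\quad a_2=T^1_{31}$$ (rows $i=1,2,3$, columns $23,31,12$). At each $b\in B_2$ there is exactly one pair $(a_1,a_2)$ for which this normal form is a torsion matrix at $b$. 4. The function $\mathcal M=a_1^2+a_2^2$ on $B_2$ is invariant under $G_2$, so it descends to a smooth function on $M$. It is a differential invariant of $\mathcal S$: if a map $f$ from $M$ to a second manifold $M'$ with an oriented contact sub-Riemannian surface $\mathcal S'$ is, near $p$, a local diffeomorphism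 carrying planes to planes and scalar product to scalar product (not necessarily preserving orientations), then $\mathcal M_{\mathcal S'}(f(p))=\mathcal M_{\mathcal S}(p)$. -/

import Mathlib

open scoped Manifold ContDiff Topology Matrix

noncomputable section

namespace SubRiemannian

/-- The model space `ℝ³`. -/
abbrev R3 : Type := EuclideanSpace ℝ (Fin 3)

/-! ### The groups `G₀ ⊇ G₁ ⊇ G₂` and their Lie algebras -/

/-- The general element of `G₀` (when `z ≠ 0`). -/
def groupMatrix (φ x y z : ℝ) : Matrix (Fin 3) (Fin 3) ℝ :=
  !![Real.cos φ, -Real.sin φ, x; Real.sin φ, Real.cos φ, y; 0, 0, z]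

theorem groupMatrix_mul (φ x y z φ' x' y' z' : ℝ) :
    groupMatrix φ x y z * groupMatrix φ' x' y' z' =
      groupMatrix (φ + φ') (Real.cos φ * x' - Real.sin φ * y' + x * z')
        (Real.sin φ * x' + Real.cos φ * y' + y * z') (z * z') := by
  ext i j
  fin_cases i <;> fin_cases j <;>
    simp [groupMatrix, Matrix.mul_apply, Fin.sum_univ_three, Real.cos_add, Real.sin_add] <;> ring

theorem groupMatrix_one : groupMatrix 0 0 0 1 = 1 := by
  ext i j
  fin_cases i <;> fin_cases j <;> simp [groupMatrix]

theorem groupMatrix_inv (g : GL (Fin 3) ℝ) (φ x y z : ℝ) (hz : z ≠ 0)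
    (hg : (g : Matrix (Fin 3) (Fin 3) ℝ) = groupMatrix φ x y z) :
    ((g⁻¹ : GL (Fin 3) ℝ) : Matrix (Fin 3) (Fin 3) ℝ) =
      groupMatrix (-φ) (-(Real.cos φ * x + Real.sin φ * y) / z)
        (-(Real.cos φ * y - Real.sin φ * x) / z) z⁻¹ := by
  rw [Matrix.coe_units_inv]
  apply Matrix.inv_eq_right_inv
  rw [hg, groupMatrix_mul, ← groupMatrix_one]
  have h := Real.sin_sq_add_cos_sq φ
  congr 1
  · ring
  · field_simp
    linear_combination (-x) * h
  · field_simp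
    linear_combination (-y) * h
  · field_simp

/-- `G₀`: the group of the matrices `(cos φ₁, -sin φ₁, φ₂; sin φ₁, cos φ₁, φ₃; 0, 0, φ₄)` with
`φ₄ ≠ 0`. -/
def G₀ : Subgroup (GL (Fin 3) ℝ) where
  carrier := {g | ∃ φ₁ φ₂ φ₃ φ₄ : ℝ, φ₄ ≠ 0 ∧
    (g : Matrix (Fin 3) (Fin 3) ℝ) = groupMatrix φ₁ φ₂ φ₃ φ₄}
  mul_mem' := by
    rintro a b ⟨φ, x, y, z, hz, h⟩ ⟨φ', x', y', z', hz', h'⟩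
    exact ⟨_, _, _, _, mul_ne_zero hz hz', by rw [Units.val_mul, h, h', groupMatrix_mul]⟩
  one_mem' := ⟨0, 0, 0, 1, one_ne_zero, by rw [groupMatrix_one, Units.val_one]⟩
  inv_mem' := by
    rintro a ⟨φ, x, y, z, hz, h⟩
    exact ⟨_, _, _, _, inv_ne_zero hz, groupMatrix_inv a φ x y z hz h⟩

/-- `G₁`: the subgroup of `G₀` given by `φ₄ = 1`. -/
def G₁ : Subgroup (GL (Fin 3) ℝ) where
  carrier := {g | ∃ φ₁ φ₂ φ₃ : ℝ, (g : Matrix (Fin 3) (Fin 3) ℝ) = groupMatrix φ₁ φ₂ φ₃ 1}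
  mul_mem' := by
    rintro a b ⟨φ, x, y, h⟩ ⟨φ', x', y', h'⟩
    exact ⟨_, _, _, by rw [Units.val_mul, h, h', groupMatrix_mul, mul_one 1]⟩
  one_mem' := ⟨0, 0, 0, by rw [groupMatrix_one, Units.val_one]⟩
  inv_mem' := by
    rintro a ⟨φ, x, y, h⟩
    exact ⟨_, _, _, by rw [groupMatrix_inv a φ x y 1 one_ne_zero h, inv_one]⟩

/-- `G₂`: the rotations `(cos φ, -sin φ, 0; sin φ, cos φ, 0; 0, 0, 1)`. -/
def G₂ : Subgroup (GL (Fin 3) ℝ) where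
  carrier := {g | ∃ φ : ℝ, (g : Matrix (Fin 3) (Fin 3) ℝ) = groupMatrix φ 0 0 1}
  mul_mem' := by
    rintro a b ⟨φ, h⟩ ⟨φ', h'⟩
    exact ⟨φ + φ', by rw [Units.val_mul, h, h', groupMatrix_mul]; simp⟩
  one_mem' := ⟨0, by rw [groupMatrix_one, Units.val_one]⟩
  inv_mem' := by
    rintro a ⟨φ, h⟩
    exact ⟨-φ, by rw [groupMatrix_inv a φ 0 0 1 one_ne_zero h]; simp⟩

/-- The Lie algebra of `G₀`. -/
def 𝔤₀ : Set (Matrix (Fin 3) (Fin 3) ℝ) :=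
  {A | ∃ α₁ α₂ α₃ α₄ : ℝ, A = !![0, α₁, α₂; -α₁, 0, α₃; 0, 0, α₄]}

/-- The Lie algebra of `G₁`. -/
def 𝔤₁ : Set (Matrix (Fin 3) (Fin 3) ℝ) :=
  {A | ∃ α₁ α₂ α₃ : ℝ, A = !![0, α₁, α₂; -α₁, 0, α₃; 0, 0, 0]}

/-- The Lie algebra of `G₂`. -/
def 𝔤₂ : Set (Matrix (Fin 3) (Fin 3) ℝ) :=
  {A | ∃ α₁ : ℝ, A = !![0, α₁, 0; -α₁, 0, 0; 0, 0, 0]}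

/-! ### Vector fields and 1-forms on a three-dimensional manifold -/

section Manifold

variable (M : Type*) [TopologicalSpace M] [ChartedSpace R3 M]

/-- (Not necessarily smooth) vector fields on `M`. -/
abbrev VField : Type _ := ∀ p : M, TangentSpace 𝓘(ℝ, R3) p

/-- (Not necessarily smooth) 1-forms on `M`. -/
abbrev OneForm : Type _ := ∀ p : M, TangentSpace 𝓘(ℝ, R3) p →L[ℝ] ℝ

variable {M}

/-- Triples of covectors at `p`; a coframe at `p` is a linearly independent triple. -/
abbrev Covectors (p : M) : Type := Fin 3 → (TangentSpace 𝓘(ℝ, R3) p →L[ℝ] ℝ)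

/-- The vector field `X` is smooth on `U`. -/
def VField.SmoothOn [IsManifold 𝓘(ℝ, R3) ∞ M] (X : VField M) (U : Set M) : Prop :=
  ContMDiffOn 𝓘(ℝ, R3) 𝓘(ℝ, R3).tangent ∞
    (fun p ↦ (⟨p, X p⟩ : TangentBundle 𝓘(ℝ, R3) M)) U

/-- The 1-form `α` is smooth on `U`, as a section of the cotangent bundle. -/
def OneForm.SmoothOn [IsManifold 𝓘(ℝ, R3) ∞ M] (α : OneForm M) (U : Set M) : Prop :=
  ContMDiffOn 𝓘(ℝ, R3) (𝓘(ℝ, R3).prod 𝓘(ℝ, R3 →L[ℝ] ℝ)) ∞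
    (fun p ↦ Bundle.TotalSpace.mk' (R3 →L[ℝ] ℝ)
      (E := fun p : M ↦ TangentSpace 𝓘(ℝ, R3) p →L[ℝ] Bundle.Trivial M ℝ p) p (α p)) U

/-- The function `f` is smooth on `U`. -/
def FunSmoothOn (f : M → ℝ) (U : Set M) : Prop := ContMDiffOn 𝓘(ℝ, R3) 𝓘(ℝ, ℝ) ∞ f U

/-- The exterior derivative of a 1-form on `M`, evaluated on two tangent vectors at `p`: the form
is written in the chart at `p`, where Mathlib's exterior derivative is applied. -/
def OneForm.d (α : OneForm M) (p : M) (u v : TangentSpace 𝓘(ℝ, R3) p) : ℝ :=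
  extDeriv
    (fun y : R3 ↦ ContinuousAlternatingMap.ofSubsingleton ℝ R3 ℝ (0 : Fin 1)
      ((α ((extChartAt 𝓘(ℝ, R3) p).symm y)).comp
        (mfderiv 𝓘(ℝ, R3) 𝓘(ℝ, R3) (extChartAt 𝓘(ℝ, R3) p).symm y)))
    (extChartAt 𝓘(ℝ, R3) p p)
    ![mfderiv 𝓘(ℝ, R3) 𝓘(ℝ, R3) (extChartAt 𝓘(ℝ, R3) p) p u,
      mfderiv 𝓘(ℝ, R3) 𝓘(ℝ, R3) (extChartAt 𝓘(ℝ, R3) p) p v]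

/-- The wedge product of two covectors at `p`, evaluated on two tangent vectors. -/
def wedge {p : M} (α β : TangentSpace 𝓘(ℝ, R3) p →L[ℝ] ℝ) (u v : TangentSpace 𝓘(ℝ, R3) p) : ℝ :=
  α u * β v - α v * β u

end Manifold

/-! ### Sub-Riemannian surfaces -/

/-- An oriented contact sub-Riemannian surface on the three-dimensional manifold `M`: a smooth
oriented field of tangent planes, non-holonomic at every point, with a smooth scalar product on the
planes. -/
structure SubRiemannianSurface (M : Type*) [TopologicalSpace M] [ChartedSpace R3 M]
    [IsManifold 𝓘(ℝ, R3) ∞ M] where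
  /-- the plane field -/
  Δ : ∀ p : M, Submodule ℝ (TangentSpace 𝓘(ℝ, R3) p)
  /-- the scalar product on the planes -/
  metric : ∀ p : M, LinearMap.BilinForm ℝ (Δ p)
  metric_symm : ∀ p v w, metric p v w = metric p w v
  metric_pos : ∀ p v, v ≠ 0 → 0 < metric p v v
  /-- the orientation of the planes -/
  orientation : ∀ p : M, Orientation ℝ (Δ p) (Fin 2)
  /-- near every point there are smooth vector fields `X 0, X 1` that form a positively oriented
  basis of the plane at each point and have smooth scalar products -/
  exists_frame : ∀ p : M, ∃ U : Set M, IsOpen U ∧ p ∈ U ∧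
    ∃ (X : Fin 2 → VField M) (g : Fin 2 → Fin 2 → M → ℝ),
      (∀ i, (X i).SmoothOn U) ∧ (∀ i j, FunSmoothOn (g i j) U) ∧
      ∀ q ∈ U, ∃ b : Module.Basis (Fin 2) ℝ (Δ q), b.orientation = orientation q ∧
        (∀ i, (b i : TangentSpace 𝓘(ℝ, R3) q) = X i q) ∧ ∀ i j, metric q (b i) (b j) = g i j q
  /-- `[X, Y]` is nowhere tangent to the plane field, for vector fields `X, Y` generating it -/
  nonholonomic : ∀ U : Set M, IsOpen U → ∀ X Y : VField M, X.SmoothOn U → Y.SmoothOn U →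
    (∀ q ∈ U, LinearIndependent ℝ ![X q, Y q] ∧ Submodule.span ℝ {X q, Y q} = Δ q) →
    ∀ q ∈ U, VectorField.mlieBracket 𝓘(ℝ, R3) X Y q ∉ Δ q

section Structure

variable {M : Type*} [TopologicalSpace M] [ChartedSpace R3 M]

/-- The right action `R_g η = g⁻¹ η` of a matrix on coframes at `p`, written as columns. -/
def act {p : M} (g : GL (Fin 3) ℝ) (b : Covectors p) : Covectors p :=
  fun i ↦ ∑ j, ((g⁻¹ : GL (Fin 3) ℝ) : Matrix (Fin 3) (Fin 3) ℝ) i j • b j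

variable [IsManifold 𝓘(ℝ, R3) ∞ M]

/-- `η` is a smooth section over the open set `U` of the bundle of coframes `B`. The tautological
forms `θⁱ` of `B` pull back along this section to the 1-forms `η i`. -/
structure IsSection (B : ∀ p : M, Set (Covectors p)) (U : Set M) (η : Fin 3 → OneForm M) :
    Prop where
  isOpen : IsOpen U
  smooth : ∀ i, (η i).SmoothOn U
  mem : ∀ p ∈ U, (fun i ↦ η i p) ∈ B p

/-- `B` is a `G`-structure on `M`: it has smooth local sections, and `G` acts simply transitively
on each of its fibres. -/
structure IsGStructure (B : ∀ p : M, Set (Covectors p)) (G : Subgroup (GL (Fin 3) ℝ)) :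
    Prop where
  exists_section : ∀ p : M, ∃ U η, p ∈ U ∧ IsSection B U η
  mem_iff : ∀ (p : M), ∀ b ∈ B p, ∀ b' : Covectors p, b' ∈ B p ↔ ∃! g, g ∈ G ∧ act g b = b'

/-- The structure equations on `U`, pulled back along the section `η`:
`dηⁱ = ∑ₛ ωⁱₛ ∧ ηˢ + Tⁱ₂₃ η² ∧ η³ + Tⁱ₃₁ η³ ∧ η¹ + Tⁱ₁₂ η¹ ∧ η²`,
with a smooth connection form `c = (ωⁱₛ)` with values in `𝔤` and a smooth torsion matrix `T`, whose rows are
`(Tⁱ₂₃, Tⁱ₃₁, Tⁱ₁₂)`. -/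
structure StructureEquations (𝔤 : Set (Matrix (Fin 3) (Fin 3) ℝ)) (U : Set M)
    (η : Fin 3 → OneForm M) (c : Fin 3 → Fin 3 → OneForm M)
    (T : M → Matrix (Fin 3) (Fin 3) ℝ) : Prop where
  smooth_connection : ∀ i j, (c i j).SmoothOn U
  smooth_torsion : ∀ i j, FunSmoothOn (fun p ↦ T p i j) U
  connection_mem : ∀ p ∈ U, ∀ v, Matrix.of (fun i j ↦ c i j p v) ∈ 𝔤
  equation : ∀ p ∈ U, ∀ u v i, (η i).d p u v =
    ∑ s, wedge (c i s p) (η s p) u v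
      + (T p i 0 * wedge (η 1 p) (η 2 p) u v + T p i 1 * wedge (η 2 p) (η 0 p) u v
        + T p i 2 * wedge (η 0 p) (η 1 p) u v)

/-- `T` is the value at the coframe `b ∈ B p` of the torsion of some connection on the bundle of
coframes `B`. -/
def HasTorsion (𝔤 : Set (Matrix (Fin 3) (Fin 3) ℝ)) (B : ∀ p : M, Set (Covectors p))
    {p : M} (b : Covectors p) (T : Matrix (Fin 3) (Fin 3) ℝ) : Prop :=
  ∃ U η c τ, p ∈ U ∧ IsSection B U η ∧ (fun i ↦ η i p) = b ∧
    StructureEquations 𝔤 U η c τ ∧ τ p = T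

/-- The `𝔤₂`-valued form `(0, α, 0; -α, 0, 0; 0, 0, 0)`. -/
def rotationForm (α : OneForm M) : Fin 3 → Fin 3 → OneForm M :=
  ![![0, α, 0], ![-α, 0, 0], ![0, 0, 0]]

/-- The normal form of the torsion matrix. -/
def normalForm (a₁ a₂ : ℝ) : Matrix (Fin 3) (Fin 3) ℝ :=
  !![a₁, a₂, 0; a₂, -a₁, 0; 0, 0, 1]

namespace SubRiemannianSurface

variable (S : SubRiemannianSurface M)

/-- The bundle `B₀` of adapted coframes. -/
def B₀ (p : M) : Set (Covectors p) :=
  {b | LinearIndependent ℝ b ∧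
    (∀ e : Module.Basis (Fin 2) ℝ (S.Δ p), e.orientation = S.orientation p →
      0 < Matrix.det !![b 0 (e 0), b 0 (e 1); b 1 (e 0), b 1 (e 1)]) ∧
    (∀ w : S.Δ p, b 2 w = 0) ∧
    ∀ w : S.Δ p, S.metric p w w = b 0 w ^ 2 + b 1 w ^ 2}

/-- The subbundle `B₁ ⊆ B₀` given by `T³₁₂ = 1`. -/
def B₁ (p : M) : Set (Covectors p) :=
  {b | b ∈ S.B₀ p ∧ ∃ T, HasTorsion 𝔤₀ S.B₀ b T ∧ T 2 2 = 1}

/-- The subbundle `B₂ ⊆ B₁` given by `T³₂₃ = T³₃₁ = 0`. -/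
def B₂ (p : M) : Set (Covectors p) :=
  {b | b ∈ S.B₁ p ∧ ∃ T, HasTorsion 𝔤₁ S.B₁ b T ∧ T 2 0 = 0 ∧ T 2 1 = 0}

/-- The coefficients `a = (a₁, a₂)` of a torsion matrix in normal form at the coframe `b ∈ B₂`. -/
def HasNormalTorsion {p : M} (b : Covectors p) (a : ℝ × ℝ) : Prop :=
  HasTorsion 𝔤₂ S.B₂ b (normalForm a.1 a.2)

end SubRiemannianSurface

/-- Near `p`, the map `f` is an equivalence of sub-Riemannian surfaces: it is a diffeomorphism of a
neighbourhood of `p` onto an open set, and it carries planes to planes and scalar product to scalar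
product (it need not respect the orientations). -/
def IsLocalEquivalenceAt {M' : Type*} [TopologicalSpace M'] [ChartedSpace R3 M']
    [IsManifold 𝓘(ℝ, R3) ∞ M'] (S : SubRiemannianSurface M) (S' : SubRiemannianSurface M')
    (f : M → M') (p : M) : Prop :=
  IsLocalDiffeomorphAt 𝓘(ℝ, R3) 𝓘(ℝ, R3) ∞ f p ∧
    ∀ᶠ q in 𝓝 p,
      (S.Δ q).map (mfderiv 𝓘(ℝ, R3) 𝓘(ℝ, R3) f q).toLinearMap = S'.Δ (f q) ∧
      ∀ (v w : S.Δ q) (v' w' : S'.Δ (f q)),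
        mfderiv 𝓘(ℝ, R3) 𝓘(ℝ, R3) f q v = v' → mfderiv 𝓘(ℝ, R3) 𝓘(ℝ, R3) f q w = w' →
        S'.metric (f q) v' w' = S.metric q v w

end Structure

end SubRiemannian

end

/-! Everything is measured against one local object, a reference coframe θ: adapted, with dθ³ = θ¹ ∧
θ² (`exists_isReference`). Non-holonomy allows the annihilator η³ of the planes to be scaled so that
dη³ restricts to their area form. Then dη³ = η¹∧η² + a η²∧η³ + b η³∧η¹ factors as (η¹ − aη³) ∧ (η² −
bη³), and a shear produces θ. Relative to θ the bundles B₀, B₁, B₂ are the orbits of G₀, G₁, G₂: for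
b = Aθ in B₀ the coefficient T³₁₂ is the lower right entry of A, and on B₁ the coefficients T³₂₃,
T³₃₁ are the upper right entries (`IsReference.torsion_B₀`, `IsReference.torsion_B₁`). Section and
connection do not matter, because the third row of the Lie algebra is (0, 0, *), respectively zero.

On B₂ one has dη³ = η¹ ∧ η². The third dual vector X₃ is then the Reeb field of η³, and the
symmetric part of the matrix dηⁱ(X₃, Xₖ), i, k ≤ 2, is half the Lie derivative of the metric along
X₃. The equation d²η³ = 0, used as a Jacobi identity (`IsDualOn.d_zero_eq_d_one`), makes its trace
vanish. The antisymmetric part and the coefficients of η¹ ∧ η² are absorbed by the rotation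
connection; what remains is the pair a₁, a₂.

For the invariance the orientation is dropped. Two such normal coframes differ by an orthogonal 2 ×
2 block and a sign equal to its determinant (`IsNormalCoframe.transition_block`). The derivative of
the block along X₃ contributes only an antisymmetric term, so the trace-free symmetric matrix is
conjugated by the block up to sign: (a₁, a₂) turns through a double angle, up to a reflection, and
a₁² + a₂² is unchanged. An equivalence pulls normal coframes back to normal coframes with the same
coefficients, which makes this function a differential invariant. -/

noncomputable section

namespace SubRiemannian

open VectorField

/-! ### Smooth vector fields and 1-forms -/

section SmoothFields

variable {M : Type*} [TopologicalSpace M] [ChartedSpace R3 M] [IsManifold 𝓘(ℝ, R3) ∞ M]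

theorem OneForm.SmoothOn.apply {α : OneForm M} {X : VField M} {U : Set M}
    (hα : α.SmoothOn U) (hX : X.SmoothOn U) : FunSmoothOn (fun p ↦ α p (X p)) U := by
  have h := ContMDiffOn.clm_bundle_apply (E₂ := Bundle.Trivial M ℝ) hα hX
  intro p hp
  have := h p hp
  rw [Bundle.contMDiffWithinAt_totalSpace] at this
  simpa using this.2

theorem two_le_minSmoothness : minSmoothness ℝ 2 ≤ ∞ := by
  rw [minSmoothness_of_isRCLikeNormedField]
  exact WithTop.coe_le_coe.2 (le_top (a := (2 : ℕ∞)))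

theorem three_le_minSmoothness : minSmoothness ℝ 3 ≤ ∞ := by
  rw [minSmoothness_of_isRCLikeNormedField]
  exact WithTop.coe_le_coe.2 (le_top (a := (3 : ℕ∞)))

/-- Smoothness of class `n` on the tangent bundle asks for a base of class `n + 1`; at `∞` the two
agree. -/
instance instIsManifoldAddOne : IsManifold 𝓘(ℝ, R3) (∞ + 1) M := by simpa

theorem VField.SmoothOn.bracket {X Y : VField M} {U : Set M} (hU : IsOpen U)
    (hX : X.SmoothOn U) (hY : Y.SmoothOn U) :
    VField.SmoothOn (mlieBracket 𝓘(ℝ, R3) X Y) U := by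
  intro p hp
  have : IsManifold 𝓘(ℝ, R3) (minSmoothness ℝ 2) M :=
    IsManifold.of_le (n := ∞) two_le_minSmoothness
  have := ContMDiffAt.mlieBracket_vectorField (m := ⊤) (n := ⊤)
    ((hX p hp).contMDiffAt (hU.mem_nhds hp))
    ((hY p hp).contMDiffAt (hU.mem_nhds hp)) (by simp)
  exact this.contMDiffWithinAt

theorem OneForm.SmoothOn.smul {α : OneForm M} {f : M → ℝ} {U : Set M}
    (hf : FunSmoothOn f U) (hα : α.SmoothOn U) : OneForm.SmoothOn (fun p ↦ f p • α p) U :=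
  ContMDiffOn.smul_section hf hα

theorem OneForm.SmoothOn.add {α β : OneForm M} {U : Set M}
    (hα : α.SmoothOn U) (hβ : β.SmoothOn U) : OneForm.SmoothOn (fun p ↦ α p + β p) U :=
  ContMDiffOn.add_section hα hβ

theorem OneForm.SmoothOn.sum {α : Fin 3 → OneForm M} {U : Set M}
    (hα : ∀ i, (α i).SmoothOn U) : OneForm.SmoothOn (fun p ↦ ∑ i, α i p) U :=
  ContMDiffOn.sum_section fun i _ ↦ hα i
theorem OneForm.smoothOn_zero {U : Set M} : OneForm.SmoothOn (0 : OneForm M) U :=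
  (Bundle.contMDiff_zeroSection _ _).contMDiffOn

theorem VField.SmoothOn.smul {X : VField M} {f : M → ℝ} {U : Set M}
    (hf : FunSmoothOn f U) (hX : X.SmoothOn U) : VField.SmoothOn (fun p ↦ f p • X p) U :=
  ContMDiffOn.smul_section hf hX

theorem VField.SmoothOn.add {X Y : VField M} {U : Set M}
    (hX : X.SmoothOn U) (hY : Y.SmoothOn U) : VField.SmoothOn (fun p ↦ X p + Y p) U :=
  ContMDiffOn.add_section hX hY

theorem VField.SmoothOn.sum {X : Fin 3 → VField M} {U : Set M}
    (hX : ∀ i, (X i).SmoothOn U) : VField.SmoothOn (fun p ↦ ∑ i, X i p) U :=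
  ContMDiffOn.sum_section fun i _ ↦ hX i

end SmoothFields

/-! ### Cartan's formula for the exterior derivative of a 1-form -/

section Cartan

variable {M : Type*} [TopologicalSpace M] [ChartedSpace R3 M] [IsManifold 𝓘(ℝ, R3) ∞ M]

/-- The differential of a function. -/
def differential (f : M → ℝ) : OneForm M := fun p ↦ mfderiv 𝓘(ℝ, R3) 𝓘(ℝ, ℝ) f p

/-- The 1-form `α` in the chart at `p`. -/
def OneForm.inChart (α : OneForm M) (p : M) (y : R3) : R3 →L[ℝ] ℝ :=
  (α ((extChartAt 𝓘(ℝ, R3) p).symm y)).comp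
    (mfderiv 𝓘(ℝ, R3) 𝓘(ℝ, R3) (extChartAt 𝓘(ℝ, R3) p).symm y)

/-- It suffices to evaluate on a constant vector `v`. The value is the pairing of the form with the
image of the constant field `v` under the tangent map of the inverse chart, both smooth. -/
theorem OneForm.SmoothOn.contDiffOn_inChart {α : OneForm M} {U : Set M} (hα : α.SmoothOn U)
    (p : M) : ContDiffOn ℝ ∞ (α.inChart p)
      ((extChartAt 𝓘(ℝ, R3) p).target ∩ (extChartAt 𝓘(ℝ, R3) p).symm ⁻¹' U) := by
  rw [contDiffOn_clm_apply]
  intro v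
  set φ := extChartAt 𝓘(ℝ, R3) p with hφ
  have hopen : IsOpen φ.target := isOpen_extChartAt_target p
  have hs : ContMDiffOn 𝓘(ℝ, R3) 𝓘(ℝ, R3) ∞ φ.symm φ.target := contMDiffOn_extChartAt_symm p
  have ht := hs.contMDiffOn_tangentMapWithin (m := ∞) le_rfl hopen.uniqueMDiffOn
  have hv : ContMDiff 𝓘(ℝ, R3) 𝓘(ℝ, R3).tangent ∞
      (fun y : R3 ↦ (⟨y, v⟩ : TangentBundle 𝓘(ℝ, R3) R3)) := by
    exact contMDiff_vectorSpace_iff_contDiff.2 contDiff_const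
  have h1 := ht.comp (s := φ.target ∩ φ.symm ⁻¹' U) hv.contMDiffOn (fun y hy ↦ hy.1)
  have h2 := ContMDiffOn.comp hα
    (hs.mono (Set.inter_subset_left (t := φ.symm ⁻¹' U))) (fun y hy ↦ hy.2)
  have h3 := ContMDiffOn.clm_bundle_apply (E₂ := Bundle.Trivial M ℝ) h2 h1
  rw [← contMDiffOn_iff_contDiffOn]
  intro y hy
  have := h3 y hy
  rw [Bundle.contMDiffWithinAt_totalSpace] at this
  have h4 := this.2
  refine h4.congr_of_eventuallyEq_of_mem ?_ hy
  filter_upwards [self_mem_nhdsWithin] with z hz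
  change (α (φ.symm z)) (mfderiv 𝓘(ℝ, R3) 𝓘(ℝ, R3) φ.symm z v) =
    (α (φ.symm z)) (mfderivWithin 𝓘(ℝ, R3) 𝓘(ℝ, R3) φ.symm φ.target z v)
  rw [mfderivWithin_of_isOpen hopen hz.1]

omit [IsManifold 𝓘(ℝ, R3) ∞ M] in
theorem OneForm.d_eq (α : OneForm M) (p : M) (u v : TangentSpace 𝓘(ℝ, R3) p) :
    α.d p u v = extDeriv (fun y ↦ ContinuousAlternatingMap.ofSubsingleton ℝ R3 ℝ (0 : Fin 1)
      (α.inChart p y)) (extChartAt 𝓘(ℝ, R3) p p)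
    ![mfderiv 𝓘(ℝ, R3) 𝓘(ℝ, R3) (extChartAt 𝓘(ℝ, R3) p) p u,
      mfderiv 𝓘(ℝ, R3) 𝓘(ℝ, R3) (extChartAt 𝓘(ℝ, R3) p) p v] := rfl

theorem OneForm.SmoothOn.differentiableAt_inChart {α : OneForm M} {U : Set M} (hα : α.SmoothOn U)
    {p : M} (hU : U ∈ 𝓝 p) :
    DifferentiableAt ℝ (α.inChart p) (extChartAt 𝓘(ℝ, R3) p p) := by
  refine ((hα.contDiffOn_inChart p).contDiffAt ?_).differentiableAt (by simp)
  refine Filter.inter_mem (extChartAt_target_mem_nhds p) ?_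
  exact (continuousAt_extChartAt_symm p).preimage_mem_nhds (by simpa [extChartAt_to_inv] using hU)

/-- The differential at `p` of the chart at `p`. -/
def chartD (p : M) : TangentSpace 𝓘(ℝ, R3) p →L[ℝ] R3 :=
  mfderiv 𝓘(ℝ, R3) 𝓘(ℝ, R3) (extChartAt 𝓘(ℝ, R3) p) p

theorem OneForm.inChart_chartD (α : OneForm M) (p : M) (z : TangentSpace 𝓘(ℝ, R3) p) :
    α.inChart p (extChartAt 𝓘(ℝ, R3) p p) (chartD p z) = α p z := by
  have : IsManifold 𝓘(ℝ, R3) 1 M := IsManifold.of_le (n := ∞) (by simp)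
  have h := DFunLike.congr_fun (mfderivWithin_extChartAt_symm_comp_mfderiv_extChartAt'
    (I := 𝓘(ℝ, R3)) (mem_extChartAt_source (I := 𝓘(ℝ, R3)) p)) z
  have hrange : Set.range 𝓘(ℝ, R3) = Set.univ := by simp
  rw [hrange, mfderivWithin_univ] at h
  -- The point read back from the chart equals `p` only propositionally; `hfib` transports along
  -- this equality, every tangent space being a copy of `R3`.
  have hfib : ∀ (f : M → R3 → ℝ) (q : M), q = p → f q z = f p z := by rintro Z _ rfl; rfl
  refine Eq.trans ?_ (hfib (fun q z ↦ α q z) _ (extChartAt_to_inv (I := 𝓘(ℝ, R3)) p))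
  exact congrArg (α ((extChartAt 𝓘(ℝ, R3) p).symm (extChartAt 𝓘(ℝ, R3) p p))) h

theorem OneForm.SmoothOn.d_eq_sub {α : OneForm M} {U : Set M} (hα : α.SmoothOn U)
    {p : M} (hU : U ∈ 𝓝 p) (u v : TangentSpace 𝓘(ℝ, R3) p) :
    α.d p u v =
      fderiv ℝ (α.inChart p) (extChartAt 𝓘(ℝ, R3) p p) (chartD p u) (chartD p v) -
      fderiv ℝ (α.inChart p) (extChartAt 𝓘(ℝ, R3) p p) (chartD p v) (chartD p u) := by
  have h := hα.differentiableAt_inChart hU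
  have hd : DifferentiableAt ℝ (fun y ↦ ContinuousAlternatingMap.ofSubsingleton ℝ R3 ℝ (0 : Fin 1)
      (α.inChart p y)) (extChartAt 𝓘(ℝ, R3) p p) := by
    let e : (R3 →L[ℝ] ℝ) ≃ₗᵢ[ℝ] (R3 [⋀^Fin 1]→L[ℝ] ℝ) :=
      ContinuousAlternatingMap.ofSubsingletonLIE 0
    exact e.toContinuousLinearEquiv.differentiableAt.comp _ h
  have key (w z : R3) : fderiv ℝ (fun x ↦ α.inChart p x w) (extChartAt 𝓘(ℝ, R3) p p) z =
      fderiv ℝ (α.inChart p) (extChartAt 𝓘(ℝ, R3) p p) z w := by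
    rw [fderiv_clm_apply h (differentiableAt_const w)]
    simp
  rw [OneForm.d_eq, extDeriv_apply hd, Fin.sum_univ_two, ← key, ← key, sub_eq_add_neg]
  congr 1
  · simp only [Fin.val_zero, pow_zero, one_smul]
    rfl
  · simp only [Fin.val_one, pow_one, neg_smul, one_smul]
    rfl

/-- Cartan's formula. In the chart at `p` the bracket is that of the pulled-back fields; expanding
the derivatives of α(Y) and α(X) by the product rule, the terms that differentiate the fields are
exactly α of the bracket. -/
theorem OneForm.SmoothOn.d_apply_vectorField {α : OneForm M} {X Y : VField M} {U : Set M}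
    (hU : IsOpen U) (hα : α.SmoothOn U) (hX : X.SmoothOn U) (hY : Y.SmoothOn U) {p : M}
    (hp : p ∈ U) :
    α.d p (X p) (Y p) =
      differential (fun q ↦ α q (Y q)) p (X p) - differential (fun q ↦ α q (X q)) p (Y p) -
      α p (mlieBracket 𝓘(ℝ, R3) X Y p) := by
  have hman : IsManifold 𝓘(ℝ, R3) 2 M :=
    IsManifold.of_le (n := ∞) (le_minSmoothness.trans two_le_minSmoothness)
  have hman1 : IsManifold 𝓘(ℝ, R3) 1 M :=
    IsManifold.of_le (n := ∞) (by simp)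
  have hrange : Set.range 𝓘(ℝ, R3) = Set.univ := by simp
  have hUp := hU.mem_nhds hp
  have hL := hα.differentiableAt_inChart hUp
  have hinv : ∀ y ∈ (extChartAt 𝓘(ℝ, R3) p).target,
      (mfderiv 𝓘(ℝ, R3) 𝓘(ℝ, R3) (extChartAt 𝓘(ℝ, R3) p).symm y).IsInvertible := by
    intro y hy
    have := isInvertible_mfderivWithin_extChartAt_symm (I := 𝓘(ℝ, R3)) hy
    rwa [hrange, mfderivWithin_univ] at this
  have hp' := mem_extChartAt_target (I := 𝓘(ℝ, R3)) p
  have hsymm : (extChartAt 𝓘(ℝ, R3) p).symm (extChartAt 𝓘(ℝ, R3) p p) = p := extChartAt_to_inv p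
  have hfib : ∀ (Z : M → R3) (q : M), q = p → Z q = Z p := by rintro Z _ rfl; rfl
  -- Each field gets a chart representative typed as a plain map `R3 → R3`, to which calculus on a
  -- vector space applies.
  have key : ∀ Z : VField M, Z.SmoothOn U → ∃ Z' : R3 → R3,
      mpullbackWithin 𝓘(ℝ, R3) 𝓘(ℝ, R3) (extChartAt 𝓘(ℝ, R3) p).symm Z
        (Set.range 𝓘(ℝ, R3)) = Z' ∧
      DifferentiableAt ℝ Z' (extChartAt 𝓘(ℝ, R3) p p) ∧
      Z' (extChartAt 𝓘(ℝ, R3) p p) = chartD p (Z p) ∧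
      ∀ z : TangentSpace 𝓘(ℝ, R3) p,
        differential (fun q ↦ α q (Z q)) p z =
        fderiv ℝ (fun y ↦ α.inChart p y (Z' y)) (extChartAt 𝓘(ℝ, R3) p p) (chartD p z) := by
    intro Z hZ
    have h3 : ∀ y ∈ (extChartAt 𝓘(ℝ, R3) p).target,
        α.inChart p y (mpullbackWithin 𝓘(ℝ, R3) 𝓘(ℝ, R3) (extChartAt 𝓘(ℝ, R3) p).symm Z
        (Set.range 𝓘(ℝ, R3)) y) =
        α ((extChartAt 𝓘(ℝ, R3) p).symm y) (Z ((extChartAt 𝓘(ℝ, R3) p).symm y)) := by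
      intro y hy
      rw [mpullbackWithin_apply, hrange, mfderivWithin_univ]
      change α _ ((mfderiv 𝓘(ℝ, R3) 𝓘(ℝ, R3) (extChartAt 𝓘(ℝ, R3) p).symm y) _) = _
      rw [(hinv y hy).self_apply_inverse]
    have hdiff : DifferentiableAt ℝ (mpullbackWithin 𝓘(ℝ, R3) 𝓘(ℝ, R3)
        (extChartAt 𝓘(ℝ, R3) p).symm Z (Set.range 𝓘(ℝ, R3)) : R3 → R3)
        (extChartAt 𝓘(ℝ, R3) p p) := by
      have := MDifferentiableWithinAt.differentiableWithinAt_mpullbackWithin_vectorField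
        (((hZ p hp).contMDiffAt hUp).mdifferentiableAt (by simp)).mdifferentiableWithinAt
          (s := Set.univ)
      rw [Set.preimage_univ, Set.univ_inter] at this
      exact DifferentiableWithinAt.differentiableAt this (by rw [hrange]; exact Filter.univ_mem)
    refine ⟨_, rfl, hdiff, ?_, ?_⟩
    · rw [mpullbackWithin_apply]
      refine ((isInvertible_mfderivWithin_extChartAt_symm hp').inverse_apply_eq).2 ?_
      have h := DFunLike.congr_fun (mfderivWithin_extChartAt_symm_comp_mfderiv_extChartAt'
        (I := 𝓘(ℝ, R3)) (mem_extChartAt_source (I := 𝓘(ℝ, R3)) p)) (Z p)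
      refine Eq.trans ?_ h.symm
      exact hfib Z _ hsymm
    · intro z
      have hf : MDifferentiableAt 𝓘(ℝ, R3) 𝓘(ℝ, ℝ) (fun q ↦ α q (Z q)) p :=
        ((hα.apply hZ p hp).contMDiffAt hUp).mdifferentiableAt (by simp)
      have e1 : (fun q ↦ α q (Z q)) =ᶠ[𝓝 p] (fun y ↦ α.inChart p y
          (mpullbackWithin 𝓘(ℝ, R3) 𝓘(ℝ, R3) (extChartAt 𝓘(ℝ, R3) p).symm Z
        (Set.range 𝓘(ℝ, R3)) y)) ∘ (extChartAt 𝓘(ℝ, R3) p) := by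
        filter_upwards [extChartAt_source_mem_nhds (I := 𝓘(ℝ, R3)) p] with q hq
        refine Eq.trans ?_ (h3 _ ((extChartAt 𝓘(ℝ, R3) p).map_source hq)).symm
        exact congrArg (fun q ↦ α q (Z q)) ((extChartAt 𝓘(ℝ, R3) p).left_inv hq).symm
      unfold differential
      rw [e1.mfderiv_eq]
      have hg := hL.clm_apply hdiff
      rw [mfderiv_comp p hg.mdifferentiableAt (mdifferentiableAt_extChartAt (by simp)),
        mfderiv_eq_fderiv]
      rfl
  obtain ⟨X', hX1, hX2, hX4, hX5⟩ := key X hX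
  obtain ⟨Y', hY1, hY2, hY4, hY5⟩ := key Y hY
  have hbr : α p (mlieBracket 𝓘(ℝ, R3) X Y p) =
      α.inChart p (extChartAt 𝓘(ℝ, R3) p p) (lieBracket ℝ X' Y' (extChartAt 𝓘(ℝ, R3) p p)) := by
    obtain ⟨w, hw⟩ : ∃ w : R3, w = lieBracketWithin ℝ X' Y' Set.univ (extChartAt 𝓘(ℝ, R3) p p) :=
      ⟨_, rfl⟩
    have hm : mlieBracket 𝓘(ℝ, R3) X Y p =
        (mfderiv 𝓘(ℝ, R3) 𝓘(ℝ, R3) (extChartAt 𝓘(ℝ, R3) p) p).inverse w := by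
      subst hw hX1 hY1
      rw [mlieBracket, mlieBracketWithin_apply, Set.preimage_univ, Set.univ_inter]
      nth_rw 3 [hrange]
    rw [hm, ← OneForm.inChart_chartD, ← lieBracketWithin_univ, ← hw]
    congr 1
    exact (isInvertible_mfderiv_extChartAt (I := 𝓘(ℝ, R3))
      (mem_extChartAt_source p)).self_apply_inverse _
  rw [hα.d_eq_sub hUp, hbr, hY5, hX5, ← hX4, ← hY4,
    fderiv_clm_apply hL hX2, fderiv_clm_apply hL hY2]
  simp [lieBracket]
  ring

end Cartan

/-! ### Dual triples of vectors and covectors -/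

section LinearAlgebra

variable {M : Type*} [TopologicalSpace M] [ChartedSpace R3 M] {p : M}

/-- The triple of tangent vectors `x` is dual to the triple of covectors `b`. -/
def IsDual (b : Covectors p) (x : Fin 3 → TangentSpace 𝓘(ℝ, R3) p) : Prop :=
  ∀ i j, b i (x j) = if i = j then 1 else 0

instance instT2SpaceTangentSpace : T2Space (TangentSpace 𝓘(ℝ, R3) p) :=
  inferInstanceAs (T2Space R3)

variable {b b' : Covectors p} {x x' : Fin 3 → TangentSpace 𝓘(ℝ, R3) p}

theorem finrank_tangentSpace : Module.finrank ℝ (TangentSpace 𝓘(ℝ, R3) p) = 3 :=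
  finrank_euclideanSpace_fin

instance instFiniteDimensionalTangentSpace : FiniteDimensional ℝ (TangentSpace 𝓘(ℝ, R3) p) :=
  inferInstanceAs (FiniteDimensional ℝ R3)

theorem IsDual.linearIndependent_vec (h : IsDual b x) : LinearIndependent ℝ x := by
  rw [Fintype.linearIndependent_iff]
  intro c hc i
  have := congrArg (b i) hc
  simpa [map_sum, h i _] using this

theorem IsDual.linearIndependent (h : IsDual b x) : LinearIndependent ℝ b := by
  rw [Fintype.linearIndependent_iff]
  intro c hc i
  have := DFunLike.congr_fun hc (x i)
  simpa [sum_apply, h _ i] using this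

theorem IsDual.expand_vec (h : IsDual b x) (v : TangentSpace 𝓘(ℝ, R3) p) :
    v = ∑ j, b j v • x j := by
  let e := basisOfLinearIndependentOfCardEqFinrank h.linearIndependent_vec
    (by rw [finrank_tangentSpace, Fintype.card_fin])
  have he : ∀ i, e i = x i := fun i ↦ by simp [e]
  have h1 : ∀ j, b j v = e.repr v j := by
    intro j
    conv_lhs => rw [← e.sum_repr v]
    simp [map_sum, he, h j _]
  simp_rw [h1, ← he]
  exact (e.sum_repr v).symm

theorem IsDual.expand_covec (h : IsDual b x) (β : TangentSpace 𝓘(ℝ, R3) p →L[ℝ] ℝ) :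
    β = ∑ j, β (x j) • b j := by
  ext v
  conv_lhs => rw [h.expand_vec v]
  simp [map_sum, mul_comm]

theorem IsDual.apply_expand (h : IsDual b x) (β : TangentSpace 𝓘(ℝ, R3) p →L[ℝ] ℝ)
    (v : TangentSpace 𝓘(ℝ, R3) p) : β v = ∑ j, β (x j) * b j v := by
  conv_lhs => rw [h.expand_covec β]
  simp

theorem IsDual.matrix_mul (h : IsDual b x) (h' : IsDual b' x') :
    (Matrix.of fun i j ↦ b i (x' j)) * (Matrix.of fun i j ↦ b' i (x j)) = 1 := by
  ext i j
  rw [Matrix.mul_apply]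
  simp only [Matrix.of_apply]
  rw [← h'.apply_expand, h i j, Matrix.one_apply]

theorem exists_isDual_of_linearIndependent_vec (hx : LinearIndependent ℝ x) :
    ∃ b : Covectors p, IsDual b x := by
  let e := basisOfLinearIndependentOfCardEqFinrank hx
    (by rw [finrank_tangentSpace, Fintype.card_fin])
  have he : ∀ i, e i = x i := fun i ↦ by simp [e]
  refine ⟨fun i ↦ LinearMap.toContinuousLinearMap (e.coord i), fun i j ↦ ?_⟩
  rw [← he]
  simp [Finsupp.single_apply, eq_comm (a := j)]

/-- A kernel of v ↦ (bᵢ v) would make its range proper, hence annihilated by a nonzero functional on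
ℝ³, whose coefficients would be a linear relation among the bᵢ. So the map is bijective, and the
dual vectors are the preimages of the standard basis. -/
theorem exists_isDual (hb : LinearIndependent ℝ b) :
    ∃ x : Fin 3 → TangentSpace 𝓘(ℝ, R3) p, IsDual b x := by
  let f : TangentSpace 𝓘(ℝ, R3) p →ₗ[ℝ] (Fin 3 → ℝ) := LinearMap.pi fun i ↦ (b i).toLinearMap
  have hinj : Function.Injective f := by
    rw [← LinearMap.ker_eq_bot]
    by_contra hne
    have hr : Module.finrank ℝ (LinearMap.range f) < 3 := by
      have := f.finrank_range_add_finrank_ker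
      have h0 : Module.finrank ℝ (LinearMap.ker f) ≠ 0 := by
        rwa [Ne, Submodule.finrank_eq_zero]
      rw [finrank_tangentSpace] at this
      omega
    have hlt : LinearMap.range f < ⊤ := by
      rw [lt_top_iff_ne_top]
      intro htop
      rw [htop] at hr
      simp at hr
    obtain ⟨g, hg, hg'⟩ := Submodule.exists_le_ker_of_lt_top _ hlt
    refine hg (LinearMap.pi_ext' fun i ↦ LinearMap.ext_ring ?_)
    have := Fintype.linearIndependent_iff.1 hb (fun i ↦ g (Pi.single i 1)) ?_ i
    · simpa using this
    · ext v
      have hv : g (f v) = 0 := hg' (LinearMap.mem_range_self f v)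
      rw [LinearMap.pi_apply_eq_sum_univ] at hv
      have hs : ∀ i : Fin 3, (fun j ↦ if i = j then (1 : ℝ) else 0) = Pi.single i 1 :=
        fun i ↦ funext fun j ↦ by simp [Pi.single_apply, eq_comm (a := i)]
      simp_rw [hs] at hv
      simpa [f, sum_apply, mul_comm] using hv
  have hsurj : Function.Surjective f :=
    (LinearMap.injective_iff_surjective_of_finrank_eq_finrank
      (by rw [finrank_tangentSpace]; simp)).1 hinj
  choose y hy using hsurj
  refine ⟨fun j ↦ y (Pi.single j 1), fun i j ↦ ?_⟩
  have := congrFun (hy (Pi.single j 1)) i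
  simpa [f, Pi.single_apply] using this

end LinearAlgebra

/-! ### Smoothness of dual frames and coframes -/

section Smooth
variable {M : Type*} [TopologicalSpace M] [ChartedSpace R3 M]

section Functions
variable {f g : M → ℝ} {U : Set M}

theorem FunSmoothOn.add (hf : FunSmoothOn f U) (hg : FunSmoothOn g U) :
    FunSmoothOn (fun p ↦ f p + g p) U := ContMDiffOn.add hf hg
theorem FunSmoothOn.sub (hf : FunSmoothOn f U) (hg : FunSmoothOn g U) :
    FunSmoothOn (fun p ↦ f p - g p) U := ContMDiffOn.sub hf hg
theorem FunSmoothOn.neg (hf : FunSmoothOn f U) : FunSmoothOn (fun p ↦ -f p) U := ContMDiffOn.neg hf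
theorem FunSmoothOn.mul (hf : FunSmoothOn f U) (hg : FunSmoothOn g U) :
    FunSmoothOn (fun p ↦ f p * g p) U := ContMDiffOn.mul hf hg
theorem FunSmoothOn.const (c : ℝ) : FunSmoothOn (fun _ : M ↦ c) U := contMDiffOn_const
theorem FunSmoothOn.inv (hf : FunSmoothOn f U) (h : ∀ p ∈ U, f p ≠ 0) :
    FunSmoothOn (fun p ↦ (f p)⁻¹) U := fun p hp ↦
  ContMDiffAt.comp_contMDiffWithinAt p (contDiffAt_inv ℝ (h p hp)).contMDiffAt (hf p hp)
theorem FunSmoothOn.sqrt (hf : FunSmoothOn f U) (h : ∀ p ∈ U, f p ≠ 0) :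
    FunSmoothOn (fun p ↦ √(f p)) U := fun p hp ↦
  ContMDiffAt.comp_contMDiffWithinAt p (Real.contDiffAt_sqrt (h p hp)).contMDiffAt (hf p hp)
theorem FunSmoothOn.congr (hf : FunSmoothOn f U) (h : ∀ p ∈ U, g p = f p) : FunSmoothOn g U :=
  ContMDiffOn.congr hf h

theorem FunSmoothOn.det {A : M → Matrix (Fin 3) (Fin 3) ℝ}
    (hA : ∀ i j, FunSmoothOn (fun p ↦ A p i j) U) : FunSmoothOn (fun p ↦ (A p).det) U := by
  simp_rw [Matrix.det_fin_three]
  repeat'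
    first
      | apply FunSmoothOn.add
      | apply FunSmoothOn.sub
      | apply FunSmoothOn.neg
      | apply FunSmoothOn.mul
      | apply hA

theorem FunSmoothOn.matrix_inv {A : M → Matrix (Fin 3) (Fin 3) ℝ}
    (hA : ∀ i j, FunSmoothOn (fun p ↦ A p i j) U) (h : ∀ p ∈ U, (A p).det ≠ 0) (i j : Fin 3) :
    FunSmoothOn (fun p ↦ (A p)⁻¹ i j) U := by
  -- Cramer's rule: the entries of the inverse are quotients of polynomials in the entries of `A`.
  have h1 : ∀ p, (A p)⁻¹ i j = ((A p).det)⁻¹ * ((A p).updateRow j (Pi.single i 1)).det := by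
    intro p
    rw [Matrix.inv_def, Ring.inverse_eq_inv', Matrix.smul_apply, Matrix.adjugate_apply, smul_eq_mul]
  simp_rw [h1]
  refine ((FunSmoothOn.det hA).inv h).mul (FunSmoothOn.det fun k l ↦ ?_)
  by_cases hk : k = j
  · subst hk
    simpa using FunSmoothOn.const _
  · simpa [Matrix.updateRow_ne hk] using hA k l

end Functions

variable [IsManifold 𝓘(ℝ, R3) ∞ M] {U : Set M} {η : Fin 3 → OneForm M} {X : Fin 3 → VField M}

theorem exists_smooth_frame (p : M) : ∃ V, IsOpen V ∧ p ∈ V ∧ ∃ E : Fin 3 → VField M,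
    (∀ i, (E i).SmoothOn V) ∧ ∀ q ∈ V, LinearIndependent ℝ (fun i ↦ E i q) := by
  have h :=
    (trivializationAt R3 (TangentSpace (M := M) 𝓘(ℝ, R3)) p).isLocalFrameOn_localFrame_baseSet
    𝓘(ℝ, R3) ∞ (EuclideanSpace.basisFun (Fin 3) ℝ).toBasis
  exact ⟨_, (trivializationAt R3 (TangentSpace (M := M) 𝓘(ℝ, R3)) p).open_baseSet,
    FiberBundle.mem_baseSet_trivializationAt' p, _, h.contMDiffOn,
    fun q hq ↦ h.linearIndependent hq⟩

theorem exists_smooth_coframe (p : M) : ∃ V, IsOpen V ∧ p ∈ V ∧ ∃ E : Fin 3 → OneForm M,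
    (∀ i, (E i).SmoothOn V) ∧ ∀ q ∈ V, LinearIndependent ℝ (fun i ↦ E i q) := by
  have hf : Module.finrank ℝ (R3 →L[ℝ] ℝ) = 3 := by
    rw [← (LinearMap.toContinuousLinearMap (𝕜 := ℝ) (E := R3) (F' := ℝ)).finrank_eq]
    simp
  let e := (trivializationAt (R3 →L[ℝ] ℝ)
    (fun p : M ↦ TangentSpace 𝓘(ℝ, R3) p →L[ℝ] Bundle.Trivial M ℝ p) p)
  have h := e.isLocalFrameOn_localFrame_baseSet
    𝓘(ℝ, R3) ∞ (Module.finBasisOfFinrankEq _ _ hf)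
  exact ⟨_, e.open_baseSet,
    FiberBundle.mem_baseSet_trivializationAt' p, _, h.contMDiffOn,
    fun q hq ↦ h.linearIndependent hq⟩

/-- Against any local smooth frame `E`, the coefficients of the dual frame are entries of the
inverse of the smooth matrix ηⁱ(Eⱼ). -/
theorem smoothOn_frame_of_isDual (hU : IsOpen U) (hη : ∀ i, (η i).SmoothOn U)
    (h : ∀ q ∈ U, IsDual (fun i ↦ η i q) (fun i ↦ X i q)) (k : Fin 3) : (X k).SmoothOn U := by
  intro p hp
  obtain ⟨V, hV, hpV, E, hE, hli⟩ := exists_smooth_frame p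
  have hUV : IsOpen (U ∩ V) := hU.inter hV
  have key : ∀ q ∈ U ∩ V, ((Matrix.of fun i j ↦ η i q (E j q)).det ≠ 0) ∧
      X k q = ∑ j, (Matrix.of fun i j ↦ η i q (E j q))⁻¹ j k • E j q := by
    intro q hq
    obtain ⟨ε, hε⟩ := exists_isDual_of_linearIndependent_vec (hli q hq.2)
    have hm := (h q hq.1).matrix_mul hε
    refine ⟨Matrix.det_ne_zero_of_right_inverse hm, ?_⟩
    rw [Matrix.inv_eq_right_inv hm]
    exact hε.expand_vec _
  have hs : VField.SmoothOn (fun q ↦ ∑ j, (Matrix.of fun i j ↦ η i q (E j q))⁻¹ j k • E j q)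
      (U ∩ V) := by
    refine VField.SmoothOn.sum fun j ↦ VField.SmoothOn.smul ?_ ((hE j).mono Set.inter_subset_right)
    exact FunSmoothOn.matrix_inv (fun i j ↦ OneForm.SmoothOn.apply
      ((hη i).mono Set.inter_subset_left)
      ((hE j).mono Set.inter_subset_right)) (fun q hq ↦ (key q hq).1) _ _
  have hs' : VField.SmoothOn (X k) (U ∩ V) :=
    ContMDiffOn.congr hs fun q hq ↦ by rw [(key q hq).2]
  exact ((hs' p ⟨hp, hpV⟩).contMDiffAt (hUV.mem_nhds ⟨hp, hpV⟩)).contMDiffWithinAt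

theorem smoothOn_coframe_of_isDual (hU : IsOpen U) (hX : ∀ i, (X i).SmoothOn U)
    (h : ∀ q ∈ U, IsDual (fun i ↦ η i q) (fun i ↦ X i q)) (k : Fin 3) : (η k).SmoothOn U := by
  intro p hp
  obtain ⟨V, hV, hpV, E, hE, hli⟩ := exists_smooth_coframe p
  have hUV : IsOpen (U ∩ V) := hU.inter hV
  have key : ∀ q ∈ U ∩ V, ((Matrix.of fun i j ↦ E i q (X j q)).det ≠ 0) ∧
      η k q = ∑ j, (Matrix.of fun i j ↦ E i q (X j q))⁻¹ k j • E j q := by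
    intro q hq
    obtain ⟨ε, hε⟩ := exists_isDual (hli q hq.2)
    have hm := hε.matrix_mul (h q hq.1)
    refine ⟨Matrix.det_ne_zero_of_right_inverse hm, ?_⟩
    rw [Matrix.inv_eq_right_inv hm]
    exact hε.expand_covec _
  have hs : OneForm.SmoothOn (fun q ↦ ∑ j, (Matrix.of fun i j ↦ E i q (X j q))⁻¹ k j • E j q)
      (U ∩ V) := by
    refine OneForm.SmoothOn.sum fun j ↦
      OneForm.SmoothOn.smul ?_ ((hE j).mono Set.inter_subset_right)
    exact FunSmoothOn.matrix_inv (fun i j ↦ OneForm.SmoothOn.apply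
      ((hE i).mono Set.inter_subset_right)
      ((hX j).mono Set.inter_subset_left)) (fun q hq ↦ (key q hq).1) _ _
  have hs' : OneForm.SmoothOn (η k) (U ∩ V) :=
    ContMDiffOn.congr hs fun q hq ↦ by rw [(key q hq).2]
  exact ((hs' p ⟨hp, hpV⟩).contMDiffAt (hUV.mem_nhds ⟨hp, hpV⟩)).contMDiffWithinAt
end Smooth

/-! ### Exterior derivatives and structure equations in a dual frame -/

section Frames

variable {M : Type*} [TopologicalSpace M] [ChartedSpace R3 M] [IsManifold 𝓘(ℝ, R3) ∞ M]
  {U V : Set M} {η : Fin 3 → OneForm M} {X : Fin 3 → VField M} {p : M}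

/-- `η` is a smooth coframe on the open set `U` with dual frame `X`. -/
structure IsDualOn (U : Set M) (η : Fin 3 → OneForm M) (X : Fin 3 → VField M) : Prop where
  isOpen : IsOpen U
  smooth : ∀ i, (η i).SmoothOn U
  smooth_frame : ∀ i, (X i).SmoothOn U
  dual : ∀ q ∈ U, IsDual (fun i ↦ η i q) (fun i ↦ X i q)

theorem exists_isDualOn (hU : IsOpen U) (hη : ∀ i, (η i).SmoothOn U)
    (h : ∀ q ∈ U, LinearIndependent ℝ (fun i ↦ η i q)) : ∃ X, IsDualOn U η X := by
  have hx : ∀ q : M, ∃ x : Fin 3 → TangentSpace 𝓘(ℝ, R3) q, q ∈ U → IsDual (fun i ↦ η i q) x := by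
    intro q
    by_cases hq : q ∈ U
    · obtain ⟨x, hx⟩ := exists_isDual (h q hq)
      exact ⟨x, fun _ ↦ hx⟩
    -- Zero is a default outside `U`, where nothing is claimed.
    · exact ⟨0, fun h ↦ (hq h).elim⟩
  choose x hx using hx
  exact ⟨fun i q ↦ x q i, hU, hη, smoothOn_frame_of_isDual hU hη hx, hx⟩

theorem exists_isDualOn_of_frame (hU : IsOpen U) (hX : ∀ i, (X i).SmoothOn U)
    (h : ∀ q ∈ U, LinearIndependent ℝ (fun i ↦ X i q)) : ∃ η, IsDualOn U η X := by
  have hx : ∀ q : M, ∃ b : Covectors q, q ∈ U → IsDual b (fun i ↦ X i q) := by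
    intro q
    by_cases hq : q ∈ U
    · obtain ⟨x, hx⟩ := exists_isDual_of_linearIndependent_vec (h q hq)
      exact ⟨x, fun _ ↦ hx⟩
    · exact ⟨0, fun h ↦ (hq h).elim⟩
  choose b hb using hx
  exact ⟨fun i q ↦ b q i, hU, smoothOn_coframe_of_isDual hU hX hb, hX, hb⟩

theorem IsDualOn.mono (h : IsDualOn U η X) (hV : IsOpen V) (hVU : V ⊆ U) : IsDualOn V η X :=
  ⟨hV, fun i ↦ (h.smooth i).mono hVU, fun i ↦ (h.smooth_frame i).mono hVU,
    fun q hq ↦ h.dual q (hVU hq)⟩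

omit [IsManifold 𝓘(ℝ, R3) ∞ M] in
theorem differential_congr {f g : M → ℝ} (hU : IsOpen U) (hp : p ∈ U) (h : ∀ q ∈ U, f q = g q) :
    differential f p = differential g p :=
  Filter.EventuallyEq.mfderiv_eq (Filter.eventually_of_mem (hU.mem_nhds hp) h)

omit [IsManifold 𝓘(ℝ, R3) ∞ M] in
theorem differential_eq_zero {f : M → ℝ} {c : ℝ} (hU : IsOpen U) (hp : p ∈ U)
    (h : ∀ q ∈ U, f q = c) : differential f p = 0 := by
  rw [differential_congr hU hp (g := fun _ ↦ c) h]
  exact mfderiv_const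

omit [IsManifold 𝓘(ℝ, R3) ∞ M] in
theorem differential_add {f g : M → ℝ} (hU : IsOpen U) (hp : p ∈ U) (hf : FunSmoothOn f U)
    (hg : FunSmoothOn g U) (v : TangentSpace 𝓘(ℝ, R3) p) :
    differential (fun q ↦ f q + g q) p v = differential f p v + differential g p v := by
  have h1 := ((hf p hp).contMDiffAt (hU.mem_nhds hp)).mdifferentiableAt (by simp)
  have h2 := ((hg p hp).contMDiffAt (hU.mem_nhds hp)).mdifferentiableAt (by simp)
  exact DFunLike.congr_fun (mfderiv_add h1 h2) v

omit [IsManifold 𝓘(ℝ, R3) ∞ M] in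
theorem differential_mul {f g : M → ℝ} (hU : IsOpen U) (hp : p ∈ U) (hf : FunSmoothOn f U)
    (hg : FunSmoothOn g U) (v : TangentSpace 𝓘(ℝ, R3) p) :
    differential (fun q ↦ f q * g q) p v = f p * differential g p v + g p * differential f p v := by
  have h1 := ((hf p hp).contMDiffAt (hU.mem_nhds hp)).mdifferentiableAt (by simp)
  have h2 := ((hg p hp).contMDiffAt (hU.mem_nhds hp)).mdifferentiableAt (by simp)
  exact DFunLike.congr_fun (h1.hasMFDerivAt.mul h2.hasMFDerivAt).mfderiv v

/-- The pairings ηⁱ(Xⱼ) are constant, so only the bracket term of Cartan's formula survives. -/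
theorem IsDualOn.d_self (h : IsDualOn U η X) (hp : p ∈ U) (i k l : Fin 3) :
    (η i).d p (X k p) (X l p) = -η i p (mlieBracket 𝓘(ℝ, R3) (X k) (X l) p) := by
  rw [(h.smooth i).d_apply_vectorField h.isOpen (h.smooth_frame k) (h.smooth_frame l) hp,
    differential_eq_zero h.isOpen hp (fun q hq ↦ h.dual q hq i l),
    differential_eq_zero h.isOpen hp (fun q hq ↦ h.dual q hq i k)]
  simp

theorem IsDualOn.smoothOn_d (h : IsDualOn U η X) (i k l : Fin 3) :
    FunSmoothOn (fun q ↦ (η i).d q (X k q) (X l q)) U :=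
  (((h.smooth i).apply ((h.smooth_frame k).bracket h.isOpen (h.smooth_frame l))).neg).congr
    fun _ hq ↦ h.d_self hq i k l

theorem IsDualOn.d_apply (h : IsDualOn U η X) {β : OneForm M} (hβ : β.SmoothOn U) (hp : p ∈ U)
    (k l : Fin 3) :
    β.d p (X k p) (X l p) = differential (fun q ↦ β q (X l q)) p (X k p)
      - differential (fun q ↦ β q (X k q)) p (X l p)
      + ∑ j, β p (X j p) * (η j).d p (X k p) (X l p) := by
  rw [hβ.d_apply_vectorField h.isOpen (h.smooth_frame k) (h.smooth_frame l) hp,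
    (h.dual p hp).apply_expand (β p)]
  simp only [h.d_self hp, mul_neg, Finset.sum_neg_distrib]
  ring

omit [IsManifold 𝓘(ℝ, R3) ∞ M] in
theorem IsDual.bilin_alt {b : Covectors p} {x : Fin 3 → TangentSpace 𝓘(ℝ, R3) p} (h : IsDual b x)
    (L : TangentSpace 𝓘(ℝ, R3) p →ₗ[ℝ] TangentSpace 𝓘(ℝ, R3) p →ₗ[ℝ] ℝ)
    (u v : TangentSpace 𝓘(ℝ, R3) p) :
    L u v - L v u = (L (x 1) (x 2) - L (x 2) (x 1)) * wedge (b 1) (b 2) u v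
      + (L (x 2) (x 0) - L (x 0) (x 2)) * wedge (b 2) (b 0) u v
      + (L (x 0) (x 1) - L (x 1) (x 0)) * wedge (b 0) (b 1) u v := by
  have hu := h.expand_vec u
  have hv := h.expand_vec v
  rw [Fin.sum_univ_three] at hu hv
  conv_lhs => rw [hu, hv]
  simp only [map_add, map_smul, LinearMap.add_apply, LinearMap.smul_apply, smul_eq_mul, wedge]
  ring

/-- At a point dα is the antisymmetrization of a bilinear form, so three pairs of basis vectors
determine it. -/
theorem IsDual.d_expand {b : Covectors p} {x : Fin 3 → TangentSpace 𝓘(ℝ, R3) p} (h : IsDual b x)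
    {α : OneForm M} (hα : α.SmoothOn U) (hU : U ∈ 𝓝 p) (u v : TangentSpace 𝓘(ℝ, R3) p) :
    α.d p u v = α.d p (x 1) (x 2) * wedge (b 1) (b 2) u v
      + α.d p (x 2) (x 0) * wedge (b 2) (b 0) u v + α.d p (x 0) (x 1) * wedge (b 0) (b 1) u v := by
  let L : TangentSpace 𝓘(ℝ, R3) p →ₗ[ℝ] TangentSpace 𝓘(ℝ, R3) p →ₗ[ℝ] ℝ :=
    LinearMap.mk₂ ℝ (fun u v ↦ fderiv ℝ (α.inChart p) (extChartAt 𝓘(ℝ, R3) p p) (chartD p u)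
      (chartD p v)) (by simp) (by simp) (by simp) (by simp)
  have hL : ∀ u v, α.d p u v = L u v - L v u := fun u v ↦ hα.d_eq_sub hU u v
  simp only [hL]
  exact h.bilin_alt L u v

theorem OneForm.SmoothOn.d_swap {α : OneForm M} (hα : α.SmoothOn U) (hU : U ∈ 𝓝 p)
    (u v : TangentSpace 𝓘(ℝ, R3) p) : α.d p u v = -α.d p v u := by
  rw [hα.d_eq_sub hU, hα.d_eq_sub hU]
  ring

/-- The torsion matrix of `η` for the zero connection. -/
def torsionMatrix (η : Fin 3 → OneForm M) (X : Fin 3 → VField M) (p : M) :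
    Matrix (Fin 3) (Fin 3) ℝ :=
  Matrix.of fun i ↦ ![(η i).d p (X 1 p) (X 2 p), (η i).d p (X 2 p) (X 0 p),
    (η i).d p (X 0 p) (X 1 p)]

/-- With the zero connection all of dη counts as torsion; this is what makes torsion matrices exist.
-/
theorem IsDualOn.structureEquations (h : IsDualOn U η X) {𝔤 : Set (Matrix (Fin 3) (Fin 3) ℝ)}
    (h0 : 0 ∈ 𝔤) : StructureEquations 𝔤 U η (fun _ _ ↦ 0) (torsionMatrix η X) where
  smooth_connection _ _ := OneForm.smoothOn_zero
  smooth_torsion i j := by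
    fin_cases j
    exacts [h.smoothOn_d i 1 2, h.smoothOn_d i 2 0, h.smoothOn_d i 0 1]
  connection_mem _ _ _ := h0
  equation p hp u v i := by
    rw [(h.dual p hp).d_expand (h.smooth i) (h.isOpen.mem_nhds hp)]
    simp [torsionMatrix, wedge]

variable {𝔤 : Set (Matrix (Fin 3) (Fin 3) ℝ)} {c : Fin 3 → Fin 3 → OneForm M}
  {T : M → Matrix (Fin 3) (Fin 3) ℝ}

theorem StructureEquations.d_eq (h : StructureEquations 𝔤 U η c T) (hp : p ∈ U)
    {x : Fin 3 → TangentSpace 𝓘(ℝ, R3) p} (hx : IsDual (fun i ↦ η i p) x) (i : Fin 3) :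
    (η i).d p (x 1) (x 2) = c i 2 p (x 1) - c i 1 p (x 2) + T p i 0 ∧
    (η i).d p (x 2) (x 0) = c i 0 p (x 2) - c i 2 p (x 0) + T p i 1 ∧
    (η i).d p (x 0) (x 1) = c i 1 p (x 0) - c i 0 p (x 1) + T p i 2 := by
  simp only [h.equation p hp, Fin.sum_univ_three, wedge, hx _ _]
  refine ⟨?_, ?_, ?_⟩ <;> simp <;> ring

end Frames

/-! ### The group action on coframes and its orbits -/

section Action

variable {M : Type*} [TopologicalSpace M] [ChartedSpace R3 M] {p : M}

theorem act_act (g h : GL (Fin 3) ℝ) (b : Covectors p) : act g (act h b) = act (h * g) b := by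
  funext i
  simp only [act, mul_inv_rev, Units.val_mul, Matrix.mul_apply, Finset.smul_sum, Finset.sum_smul,
    smul_smul]
  exact Finset.sum_comm

theorem act_injective {b : Covectors p} (hb : LinearIndependent ℝ b) {g h : GL (Fin 3) ℝ}
    (hgh : act g b = act h b) : g = h := by
  obtain ⟨x, hx⟩ := exists_isDual hb
  rw [← inv_inj]
  ext i j
  have := DFunLike.congr_fun (congrFun hgh i) (x j)
  simpa [act, sum_apply, hx _ j] using this

/-- Linear independence of one coframe makes the action free on its orbit, so a G-structure is
recognised by a smooth section whose orbit fills each fibre. -/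
theorem isGStructure_of_orbit [IsManifold 𝓘(ℝ, R3) ∞ M] {B : ∀ p : M, Set (Covectors p)}
    {G : Subgroup (GL (Fin 3) ℝ)}
    (h : ∀ p, ∃ U θ, p ∈ U ∧ IsSection B U θ ∧ LinearIndependent ℝ (fun i ↦ θ i p) ∧
      ∀ b, b ∈ B p ↔ ∃ g ∈ G, act g (fun i ↦ θ i p) = b) : IsGStructure B G where
  exists_section p := by
    obtain ⟨U, θ, hp, hs, -⟩ := h p
    exact ⟨U, θ, hp, hs⟩
  mem_iff p b hb b' := by
    obtain ⟨U, θ, hp, hs, hli, hB⟩ := h p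
    obtain ⟨g, hg, rfl⟩ := (hB b).1 hb
    rw [hB]
    constructor
    · rintro ⟨k, hk, rfl⟩
      refine ⟨g⁻¹ * k, ⟨G.mul_mem (G.inv_mem hg) hk, by rw [act_act, mul_inv_cancel_left]⟩, ?_⟩
      rintro l ⟨-, hl⟩
      rw [act_act] at hl
      rw [← act_injective hli hl, inv_mul_cancel_left]
    · rintro ⟨k, ⟨hk, rfl⟩, -⟩
      exact ⟨g * k, G.mul_mem hg hk, by rw [act_act]⟩

/-- The coframe `A b`, where `A` is the matrix `groupMatrix φ x y z`. -/
def transform (φ x y z : ℝ) (b : Covectors p) : Covectors p :=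
  ![Real.cos φ • b 0 - Real.sin φ • b 1 + x • b 2,
    Real.sin φ • b 0 + Real.cos φ • b 1 + y • b 2, z • b 2]

theorem transform_zero (b : Covectors p) : transform 0 0 0 1 b = b := by
  funext i
  fin_cases i <;> simp [transform]

theorem act_eq_transform {g : GL (Fin 3) ℝ} {φ x y z : ℝ}
    (hg : ((g⁻¹ : GL (Fin 3) ℝ) : Matrix (Fin 3) (Fin 3) ℝ) = groupMatrix φ x y z)
    (b : Covectors p) : act g b = transform φ x y z b := by
  funext i
  rw [act, hg]
  ext v
  fin_cases i <;> simp [transform, groupMatrix, Fin.sum_univ_three, sub_eq_add_neg]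

theorem exists_inv_eq_groupMatrix {φ x y z : ℝ} (hz : z ≠ 0) : ∃ g : GL (Fin 3) ℝ,
    ((g⁻¹ : GL (Fin 3) ℝ) : Matrix (Fin 3) (Fin 3) ℝ) = groupMatrix φ x y z := by
  have hdet : (groupMatrix φ x y z).det ≠ 0 := by
    have : (groupMatrix φ x y z).det = z := by
      rw [Matrix.det_fin_three]
      simp [groupMatrix]
      linear_combination z * Real.sin_sq_add_cos_sq φ
    rwa [this]
  exact ⟨(Matrix.GeneralLinearGroup.mkOfDetNeZero _ hdet)⁻¹, by rw [inv_inv]; rfl⟩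

/-- The action involves g⁻¹; since the group is closed under inversion, its orbits can be described
by the matrices themselves. -/
theorem exists_act_G₀_iff {b b' : Covectors p} :
    (∃ g ∈ G₀, act g b = b') ↔ ∃ φ x y z : ℝ, z ≠ 0 ∧ b' = transform φ x y z b := by
  constructor
  · rintro ⟨g, hg, rfl⟩
    obtain ⟨φ, x, y, z, hz, h⟩ := G₀.inv_mem hg
    exact ⟨φ, x, y, z, hz, act_eq_transform h b⟩
  · rintro ⟨φ, x, y, z, hz, rfl⟩
    obtain ⟨g, hg⟩ := exists_inv_eq_groupMatrix (φ := φ) (x := x) (y := y) hz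
    exact ⟨g, by rw [← inv_mem_iff]; exact ⟨φ, x, y, z, hz, hg⟩, act_eq_transform hg b⟩

theorem exists_act_G₁_iff {b b' : Covectors p} :
    (∃ g ∈ G₁, act g b = b') ↔ ∃ φ x y : ℝ, b' = transform φ x y 1 b := by
  constructor
  · rintro ⟨g, hg, rfl⟩
    obtain ⟨φ, x, y, h⟩ := G₁.inv_mem hg
    exact ⟨φ, x, y, act_eq_transform h b⟩
  · rintro ⟨φ, x, y, rfl⟩
    obtain ⟨g, hg⟩ := exists_inv_eq_groupMatrix (φ := φ) (x := x) (y := y) one_ne_zero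
    exact ⟨g, by rw [← inv_mem_iff]; exact ⟨φ, x, y, hg⟩, act_eq_transform hg b⟩

theorem exists_act_G₂_iff {b b' : Covectors p} :
    (∃ g ∈ G₂, act g b = b') ↔ ∃ φ : ℝ, b' = transform φ 0 0 1 b := by
  constructor
  · rintro ⟨g, hg, rfl⟩
    obtain ⟨φ, h⟩ := G₂.inv_mem hg
    exact ⟨φ, act_eq_transform h b⟩
  · rintro ⟨φ, rfl⟩
    obtain ⟨g, hg⟩ := exists_inv_eq_groupMatrix (φ := φ) (x := 0) (y := 0) one_ne_zero
    exact ⟨g, by rw [← inv_mem_iff]; exact ⟨φ, hg⟩, act_eq_transform hg b⟩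

theorem linearIndependent_transform {b : Covectors p} (hb : LinearIndependent ℝ b)
    (φ x y : ℝ) {z : ℝ} (hz : z ≠ 0) : LinearIndependent ℝ (transform φ x y z b) := by
  rw [Fintype.linearIndependent_iff] at hb ⊢
  intro c hc
  have hcs := Real.sin_sq_add_cos_sq φ
  have h := hb ![c 0 * Real.cos φ + c 1 * Real.sin φ, -c 0 * Real.sin φ + c 1 * Real.cos φ,
    c 0 * x + c 1 * y + c 2 * z] (by
      rw [Fin.sum_univ_three] at hc ⊢
      rw [← hc]
      ext v
      simp [transform]
      ring)
  have h0 : c 0 * Real.cos φ + c 1 * Real.sin φ = 0 := h 0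
  have h1 : -c 0 * Real.sin φ + c 1 * Real.cos φ = 0 := h 1
  have h2 : c 0 * x + c 1 * y + c 2 * z = 0 := h 2
  have c0 : c 0 = 0 := by
    linear_combination Real.cos φ * h0 - Real.sin φ * h1 - c 0 * hcs
  have c1 : c 1 = 0 := by
    linear_combination Real.sin φ * h0 + Real.cos φ * h1 - c 1 * hcs
  have c2 : c 2 = 0 := by
    simpa [c0, c1, hz] using h2
  intro i
  fin_cases i
  exacts [c0, c1, c2]

end Action

/-! ### Adapted coframes at a point -/

section Adapted

variable {M : Type*} [TopologicalSpace M] [ChartedSpace R3 M] [IsManifold 𝓘(ℝ, R3) ∞ M]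
  {p : M} {S : SubRiemannianSurface M} {b : Covectors p} {x : Fin 3 → TangentSpace 𝓘(ℝ, R3) p}

/-- The first two vectors of `x` form a positively oriented orthonormal basis of the plane. -/
def IsAdaptedFrame (S : SubRiemannianSurface M) (x : Fin 3 → TangentSpace 𝓘(ℝ, R3) p) : Prop :=
  ∃ f : Module.Basis (Fin 2) ℝ (S.Δ p), f.orientation = S.orientation p ∧
    (f 0 : TangentSpace 𝓘(ℝ, R3) p) = x 0 ∧ (f 1 : TangentSpace 𝓘(ℝ, R3) p) = x 1 ∧
    S.metric p (f 0) (f 0) = 1 ∧ S.metric p (f 1) (f 1) = 1 ∧ S.metric p (f 0) (f 1) = 0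

theorem IsAdaptedFrame.mem_B₀ (hx : IsAdaptedFrame S x) (hb : IsDual b x) : b ∈ S.B₀ p := by
  obtain ⟨f, hf, h0, h1, h00, h11, h01⟩ := hx
  have hw : ∀ w : S.Δ p, w = f.repr w 0 • f 0 + f.repr w 1 • f 1 := fun w ↦ by
    conv_lhs => rw [← f.sum_repr w]
    rw [Fin.sum_univ_two]
  have hw' : ∀ w : S.Δ p, (w : TangentSpace 𝓘(ℝ, R3) p) = f.repr w 0 • x 0 + f.repr w 1 • x 1 :=
    fun w ↦ by
      conv_lhs => rw [hw w]
      simp [h0, h1]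
  have b0 : ∀ w : S.Δ p, b 0 w = f.repr w 0 := fun w ↦ by
    rw [hw' w]; simp [hb 0 _]
  have b1 : ∀ w : S.Δ p, b 1 w = f.repr w 1 := fun w ↦ by
    rw [hw' w]; simp [hb 1 _]
  have b2 : ∀ w : S.Δ p, b 2 w = 0 := fun w ↦ by
    rw [hw' w]; simp [hb 2 _]
  refine ⟨hb.linearIndependent, fun e he ↦ ?_, b2, fun w ↦ ?_⟩
  · have hpos := (f.orientation_eq_iff_det_pos e).1 (hf.trans he.symm)
    rw [f.det_apply, Matrix.det_fin_two] at hpos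
    rw [Matrix.det_fin_two]
    simpa [b0, b1, Module.Basis.toMatrix_apply] using hpos
  · have h10 : S.metric p (f 1) (f 0) = 0 := by rw [S.metric_symm, h01]
    rw [b0, b1]
    conv_lhs => rw [hw w]
    simp only [map_add, map_smul, LinearMap.add_apply, LinearMap.smul_apply, smul_eq_mul, h00, h11,
      h01, h10]
    ring

theorem transform_mem_B₀ (hb : b ∈ S.B₀ p) (φ x y : ℝ) {z : ℝ} (hz : z ≠ 0) :
    transform φ x y z b ∈ S.B₀ p := by
  obtain ⟨hli, hor, hk, hm⟩ := hb
  have hcs := Real.sin_sq_add_cos_sq φ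
  refine ⟨linearIndependent_transform hli φ x y hz, fun e he ↦ ?_, fun w ↦ ?_, fun w ↦ ?_⟩
  · have := hor e he
    rw [Matrix.det_fin_two] at this ⊢
    simp [transform, hk] at this ⊢
    linear_combination this - (b 0 (e 0) * b 1 (e 1) - b 0 (e 1) * b 1 (e 0)) * hcs
  · simp [transform, hk]
  · rw [hm]
    simp [transform, hk]
    linear_combination -(b 0 w ^ 2 + b 1 w ^ 2) * hcs

/-- Vanishing on the plane kills two entries of the transition matrix; metric and orientation force
its upper left block into SO(2), whose elements are rotations. -/
theorem IsAdaptedFrame.mem_B₀_iff (hx : IsAdaptedFrame S x) (hb : IsDual b x) (b' : Covectors p) :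
    b' ∈ S.B₀ p ↔ ∃ φ x y z : ℝ, z ≠ 0 ∧ b' = transform φ x y z b := by
  constructor
  · rintro ⟨hli, hor, hk, hm⟩
    obtain ⟨f, hf, h0, h1, h00, h11, h01⟩ := hx
    have h10 : S.metric p (f 1) (f 0) = 0 := by rw [S.metric_symm, h01]
    have e00 := hm (f 0)
    have e11 := hm (f 1)
    -- Polarization: the quadratic form at the sum recovers the scalar product of the two vectors.
    have e01 := hm (f 0 + f 1)
    simp only [map_add, LinearMap.add_apply, Submodule.coe_add, h00, h11, h01, h10, h0, h1]
      at e00 e11 e01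
    have hd := hor f hf
    rw [Matrix.det_fin_two] at hd
    simp [h0, h1] at hd
    have hA := hb.expand_covec (b' 0)
    have hB := hb.expand_covec (b' 1)
    have hC := hb.expand_covec (b' 2)
    have k0 := hk (f 0)
    have k1 := hk (f 1)
    rw [h0] at k0
    rw [h1] at k1
    rw [Fin.sum_univ_three] at hA hB hC
    generalize b' 0 (x 0) = a00 at *
    generalize b' 0 (x 1) = a01 at *
    generalize b' 1 (x 0) = a10 at *
    generalize b' 1 (x 1) = a11 at *
    have o : a00 * a01 + a10 * a11 = 0 := by linear_combination (-e01 + e00 + e11) / 2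
    -- Orthogonality leaves the determinant ±1; the orientation `hd` selects 1.
    have hdet : a00 * a11 - a01 * a10 = 1 := by
      have : (a00 * a11 - a01 * a10) ^ 2 = 1 := by
        linear_combination -(a01 ^ 2 + a11 ^ 2) * e00 - e11 - (a00 * a01 + a10 * a11) * o
      nlinarith
    have r1 : a11 = a00 := by
      linear_combination a00 * hdet + a10 * o + a11 * e00
    have r2 : a01 = -a10 := by
      linear_combination -a10 * hdet + a00 * o + a01 * e00
    -- The angle is the argument of the unit complex number formed by the first column.
    have hc : ∃ φ, Real.cos φ = a00 ∧ Real.sin φ = a10 := by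
      have hn : ‖(⟨a00, a10⟩ : ℂ)‖ = 1 := by
        rw [Complex.norm_eq_sqrt_sq_add_sq, ← e00, Real.sqrt_one]
      have hne : (⟨a00, a10⟩ : ℂ) ≠ 0 := norm_ne_zero_iff.1 (by rw [hn]; exact one_ne_zero)
      exact ⟨Complex.arg ⟨a00, a10⟩, by rw [Complex.cos_arg hne, hn, div_one],
        by rw [Complex.sin_arg, hn, div_one]⟩
    obtain ⟨φ, hφ, hφ'⟩ := hc
    refine ⟨φ, b' 0 (x 2), b' 1 (x 2), b' 2 (x 2), ?_, ?_⟩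
    · intro hz
      rw [k0, k1, hz] at hC
      exact hli.ne_zero 2 (by rw [hC]; simp)
    · funext i
      fin_cases i
      · refine hA.trans ?_
        simp only [transform, hφ, hφ', r2]
        ext v
        simp [sub_eq_add_neg]
      · refine hB.trans ?_
        simp [transform, hφ, hφ', r1]
      · refine hC.trans ?_
        simp [transform, k0, k1]
  · rintro ⟨φ, u, v, z, hz, rfl⟩
    exact transform_mem_B₀ (hx.mem_B₀ hb) φ u v hz

end Adapted

/-! ### Construction of the reference coframe -/

section ReferenceCoframe

variable {M : Type*} [TopologicalSpace M] [ChartedSpace R3 M] [IsManifold 𝓘(ℝ, R3) ∞ M]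

/-- `θ` is a coframe on `U` with dual frame `X`, adapted to `S` and satisfying `dθ³ = θ¹ ∧ θ²`. -/
structure IsReference (S : SubRiemannianSurface M) (U : Set M) (θ : Fin 3 → OneForm M)
    (X : Fin 3 → VField M) : Prop extends IsDualOn U θ X where
  adapted : ∀ q ∈ U, IsAdaptedFrame S (fun i ↦ X i q)
  d_two : ∀ q ∈ U, ∀ u v, (θ 2).d q u v = wedge (θ 0 q) (θ 1 q) u v

variable (S : SubRiemannianSurface M)

theorem VField.SmoothOn.neg {X : VField M} {U : Set M}
    (hX : X.SmoothOn U) : VField.SmoothOn (fun p ↦ -X p) U :=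
  ContMDiffOn.neg_section hX

omit [IsManifold 𝓘(ℝ, R3) ∞ M] in
theorem IsDual.shear {p : M} {b : Covectors p} {x : Fin 3 → TangentSpace 𝓘(ℝ, R3) p}
    (h : IsDual b x) (r s : ℝ) :
    IsDual (p := p) ![b 0 + (-r) • b 2, b 1 + (-s) • b 2, b 2]
      ![x 0, x 1, x 2 + r • x 0 + s • x 1] := by
  have h00 := h 0 0
  have h01 := h 0 1
  have h02 := h 0 2
  have h10 := h 1 0
  have h11 := h 1 1
  have h12 := h 1 2
  have h20 := h 2 0
  have h21 := h 2 1
  have h22 := h 2 2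
  simp only [Fin.isValue, zero_ne_one, one_ne_zero, Fin.reduceEq, if_true, if_false] at *
  intro i j
  fin_cases i <;> fin_cases j <;>
    simp only [Fin.zero_eta, Fin.mk_one, Fin.reduceFinMk, Matrix.cons_val, Fin.isValue, add_apply,
      smul_apply, map_add, map_smul, smul_eq_mul, h00, h01, h02, h10, h11, h12, h20, h21, h22,
      zero_ne_one, one_ne_zero, Fin.reduceEq, if_true, if_false] <;> ring

/-- The Gram--Schmidt process. -/
theorem exists_adapted_fields (p : M) : ∃ U : Set M, IsOpen U ∧ p ∈ U ∧
    ∃ E₀ E₁ : VField M, E₀.SmoothOn U ∧ E₁.SmoothOn U ∧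
      ∀ q ∈ U, ∀ v, IsAdaptedFrame S ![E₀ q, E₁ q, v] := by
  obtain ⟨U, hU, hp, Y, g, hY, hg, h⟩ := S.exists_frame p
  have hgs : ∀ q ∈ U, 0 < g 0 0 q ∧ g 1 0 q = g 0 1 q ∧
      0 < g 0 0 q * g 1 1 q - g 0 1 q ^ 2 := by
    intro q hq
    obtain ⟨b, -, -, hb⟩ := h q hq
    have h00 : 0 < g 0 0 q := hb 0 0 ▸ S.metric_pos q (b 0) (b.ne_zero 0)
    have h10 : g 1 0 q = g 0 1 q := by rw [← hb, ← hb, S.metric_symm]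
    refine ⟨h00, h10, ?_⟩
    -- This vector is orthogonal to `b 0`; its squared length is `g 0 0 q` times the Gram
    -- determinant, which is therefore positive.
    have hne : g 0 0 q • b 1 - g 0 1 q • b 0 ≠ 0 := by
      intro h0
      have := congrArg (fun w ↦ b.repr w 1) h0
      simp at this
      exact h00.ne' this
    have := S.metric_pos q _ hne
    simp only [map_sub, map_smul, LinearMap.sub_apply, LinearMap.smul_apply, smul_eq_mul, hb, h10]
      at this
    exact pos_of_mul_pos_right (a := g 0 0 q) (by linarith) h00.le
  -- The factor `r` normalises `Y 0`, and `r * s` normalises the orthogonal vector used above.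
  let r : M → ℝ := fun q ↦ (√(g 0 0 q))⁻¹
  let s : M → ℝ := fun q ↦ (√(g 0 0 q * g 1 1 q - g 0 1 q ^ 2))⁻¹
  have hr : FunSmoothOn r U := ((hg 0 0).sqrt fun q hq ↦ (hgs q hq).1.ne').inv
    fun q hq ↦ (Real.sqrt_pos.2 (hgs q hq).1).ne'
  have hs : FunSmoothOn s U := by
    have h1 : FunSmoothOn (fun q ↦ g 0 0 q * g 1 1 q - g 0 1 q ^ 2) U := by
      simp_rw [pow_two]
      exact ((hg 0 0).mul (hg 1 1)).sub ((hg 0 1).mul (hg 0 1))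
    exact (h1.sqrt fun q hq ↦ (hgs q hq).2.2.ne').inv
      fun q hq ↦ (Real.sqrt_pos.2 (hgs q hq).2.2).ne'
  refine ⟨U, hU, hp, fun q ↦ r q • Y 0 q, fun q ↦ (r q * s q * g 0 0 q) • Y 1 q +
    (-(r q * s q * g 0 1 q)) • Y 0 q, (hY 0).smul hr, ?_, ?_⟩
  · exact ((hY 1).smul ((hr.mul hs).mul (hg 0 0))).add
      ((hY 0).smul ((hr.mul hs).mul (hg 0 1)).neg)
  · intro q hq v
    obtain ⟨h00, h10, hG⟩ := hgs q hq
    obtain ⟨b, hor, hbY, hb⟩ := h q hq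
    have hrp : 0 < r q := inv_pos.2 (Real.sqrt_pos.2 h00)
    have hsp : 0 < s q := inv_pos.2 (Real.sqrt_pos.2 hG)
    have hr2 : r q ^ 2 * g 0 0 q = 1 := by
      simp only [r, inv_pow, Real.sq_sqrt h00.le]
      exact inv_mul_cancel₀ h00.ne'
    have hs2 : s q ^ 2 * (g 0 0 q * g 1 1 q - g 0 1 q ^ 2) = 1 := by
      simp only [s, inv_pow, Real.sq_sqrt hG.le]
      exact inv_mul_cancel₀ hG.ne'
    let w : Fin 2 → S.Δ q := ![r q • b 0, (r q * s q * g 0 0 q) • b 1 +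
      (-(r q * s q * g 0 1 q)) • b 0]
    -- The change of basis is triangular with positive diagonal, so the orientation is kept.
    have hdet : 0 < b.det w := by
      rw [b.det_apply, Matrix.det_fin_two]
      simp [Module.Basis.toMatrix_apply, w]
      positivity
    have hunit : IsUnit (b.det w) := hdet.ne'.isUnit
    obtain ⟨hli, hsp⟩ := (b.is_basis_iff_det).2 hunit
    let f : Module.Basis (Fin 2) ℝ (S.Δ q) := Module.Basis.mk hli hsp.ge
    have hf : ∀ i, f i = w i := fun i ↦ by simp [f]
    refine ⟨f, ?_, ?_, ?_, ?_, ?_, ?_⟩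
    · rw [← hor, eq_comm, b.orientation_eq_iff_det_pos]
      have : ⇑f = w := funext hf
      rwa [this]
    · rw [hf]; simp [w, hbY]
    · rw [hf]; simp [w, hbY]
    · rw [hf]; simp [w, hb]; linear_combination hr2
    · rw [hf]; simp [w, hb, h10]
      linear_combination hs2 * (r q ^ 2 * g 0 0 q) + hr2
    · rw [hf, hf]; simp [w, hb]; right; ring

theorem IsAdaptedFrame.mem {S : SubRiemannianSurface M} {p : M}
    {x : Fin 3 → TangentSpace 𝓘(ℝ, R3) p} (h : IsAdaptedFrame S x) :
    LinearIndependent ℝ ![x 0, x 1] ∧ Submodule.span ℝ {x 0, x 1} = S.Δ p := by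
  obtain ⟨f, -, h0, h1, -⟩ := h
  have e : ![x 0, x 1] = (S.Δ p).subtype ∘ f := by
    funext i
    fin_cases i
    exacts [h0.symm, h1.symm]
  refine ⟨?_, ?_⟩
  · rw [e]
    exact f.linearIndependent.map' _ (Submodule.ker_subtype _)
  · have : Set.range ![x 0, x 1] = {x 0, x 1} := by simp [Matrix.range_cons, Set.pair_comm]
    rw [← this, e, Set.range_comp, Submodule.span_image, f.span_eq, Submodule.map_top,
      Submodule.range_subtype]

/-- An orthonormal frame of the planes is completed by minus its bracket, which is transverse by
non-holonomy. A shear of the dual coframe along its third form then makes dθ³ decomposable as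
required, without changing the first two frame vectors. -/
theorem exists_isReference (p : M) : ∃ U θ X, p ∈ U ∧ IsReference S U θ X := by
  obtain ⟨U, hU, hp, E₀, E₁, hE₀, hE₁, had⟩ := exists_adapted_fields S p
  have hbr := hE₀.bracket hU hE₁
  have hspan : ∀ q ∈ U, LinearIndependent ℝ ![E₀ q, E₁ q] ∧
      Submodule.span ℝ {E₀ q, E₁ q} = S.Δ q := fun q hq ↦ (had q hq 0).mem
  have hnon := S.nonholonomic U hU E₀ E₁ hE₀ hE₁ hspan
  -- The sign gives dη³(E₀, E₁) = −η³([E₀, E₁]) = 1.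
  let E : Fin 3 → VField M := ![E₀, E₁, fun q ↦ -mlieBracket 𝓘(ℝ, R3) E₀ E₁ q]
  have hE : ∀ i, (E i).SmoothOn U := by
    intro i
    fin_cases i
    exacts [hE₀, hE₁, hbr.neg]
  have hEli : ∀ q ∈ U, LinearIndependent ℝ (fun i ↦ E i q) := by
    intro q hq
    obtain ⟨h1, h2⟩ := hspan q hq
    rw [Fintype.linearIndependent_iff] at h1 ⊢
    intro c hc
    rw [Fin.sum_univ_three] at hc
    have hc : c 0 • E₀ q + c 1 • E₁ q + c 2 • -mlieBracket 𝓘(ℝ, R3) E₀ E₁ q = 0 := hc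
    have c2 : c 2 = 0 := by
      by_contra hne
      apply hnon q hq
      have : mlieBracket 𝓘(ℝ, R3) E₀ E₁ q = (c 2)⁻¹ • (c 0 • E₀ q + c 1 • E₁ q) := by
        rw [smul_neg, add_neg_eq_zero] at hc
        rw [hc, inv_smul_smul₀ hne]
      rw [this, ← h2]
      exact Submodule.smul_mem _ _ (Submodule.add_mem _
        (Submodule.smul_mem _ _ (Submodule.subset_span (by simp)))
        (Submodule.smul_mem _ _ (Submodule.subset_span (by simp))))
    rw [c2, zero_smul, add_zero] at hc
    have := h1 ![c 0, c 1] (by simpa [Fin.sum_univ_two] using hc)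
    intro i
    fin_cases i
    exacts [this 0, this 1, c2]
  obtain ⟨η, hη⟩ := exists_isDualOn_of_frame hU hE hEli
  let a : M → ℝ := fun q ↦ (η 2).d q (E 1 q) (E 2 q)
  let b : M → ℝ := fun q ↦ (η 2).d q (E 2 q) (E 0 q)
  have ha : FunSmoothOn a U := hη.smoothOn_d 2 1 2
  have hb : FunSmoothOn b U := hη.smoothOn_d 2 2 0
  have h01 : ∀ q ∈ U, (η 2).d q (E 0 q) (E 1 q) = 1 := by
    intro q hq
    rw [hη.d_self hq]
    have : mlieBracket 𝓘(ℝ, R3) (E 0) (E 1) q = -E 2 q := (neg_neg _).symm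
    rw [this, map_neg, hη.dual q hq 2 2]
    simp
  -- With `a`, `b` the coefficients of η²∧η³ and η³∧η¹ in dη³, one has dη³ = (η¹ − aη³) ∧ (η² −
  -- bη³). The third vector is corrected to keep duality.
  refine ⟨U, ![fun q ↦ η 0 q + (-a q) • η 2 q, fun q ↦ η 1 q + (-b q) • η 2 q, η 2],
    ![E 0, E 1, fun q ↦ E 2 q + a q • E 0 q + b q • E 1 q], hp, ⟨hU, ?_, ?_, ?_⟩, ?_, ?_⟩
  · intro i
    fin_cases i
    · exact (hη.smooth 0).add ((hη.smooth 2).smul ha.neg)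
    · exact (hη.smooth 1).add ((hη.smooth 2).smul hb.neg)
    · exact hη.smooth 2
  · intro i
    fin_cases i
    · exact hE 0
    · exact hE 1
    · exact ((hE 2).add ((hE 0).smul ha)).add ((hE 1).smul hb)
  · intro q hq i j
    have := (hη.dual q hq).shear (a q) (b q) i j
    rw [← this]
    fin_cases i <;> fin_cases j <;> rfl
  · intro q hq
    obtain ⟨f, hf⟩ := had q hq 0
    exact ⟨f, hf⟩
  · intro q hq u v
    have := (hη.dual q hq).d_expand (hη.smooth 2) (hU.mem_nhds hq) u v
    refine this.trans ?_
    rw [h01 q hq]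
    change a q * _ + b q * _ + 1 * _ = wedge (η 0 q + (-a q) • η 2 q) (η 1 q + (-b q) • η 2 q) u v
    simp only [wedge, add_apply, smul_apply, smul_eq_mul]
    ring

end ReferenceCoframe

/-! ### The bundles B₀, B₁, B₂ as orbits of the reference coframe -/

section Bundles

variable {M : Type*} [TopologicalSpace M] [ChartedSpace R3 M]

theorem OneForm.d_congr {α β : OneForm M} {p : M} (h : ∀ᶠ q in 𝓝 p, α q = β q)
    (u v : TangentSpace 𝓘(ℝ, R3) p) : α.d p u v = β.d p u v := by
  rw [OneForm.d_eq, OneForm.d_eq]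
  congr 1
  apply Filter.EventuallyEq.extDeriv_eq
  have := (continuousAt_extChartAt_symm (I := 𝓘(ℝ, R3)) p).eventually
    (by rwa [extChartAt_to_inv] : ∀ᶠ q in 𝓝 ((extChartAt 𝓘(ℝ, R3) p).symm
      (extChartAt 𝓘(ℝ, R3) p p)), α q = β q)
  filter_upwards [this] with y hy
  rw [OneForm.inChart, OneForm.inChart, hy]

theorem zero_mem_𝔤₀ : (0 : Matrix (Fin 3) (Fin 3) ℝ) ∈ 𝔤₀ :=
  ⟨0, 0, 0, 0, by ext i j; fin_cases i <;> fin_cases j <;> simp⟩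

theorem zero_mem_𝔤₁ : (0 : Matrix (Fin 3) (Fin 3) ℝ) ∈ 𝔤₁ :=
  ⟨0, 0, 0, by ext i j; fin_cases i <;> fin_cases j <;> simp⟩

theorem zero_mem_𝔤₂ : (0 : Matrix (Fin 3) (Fin 3) ℝ) ∈ 𝔤₂ :=
  ⟨0, by ext i j; fin_cases i <;> fin_cases j <;> simp⟩

variable [IsManifold 𝓘(ℝ, R3) ∞ M] {U V : Set M} {S : SubRiemannianSurface M}
  {θ η : Fin 3 → OneForm M} {X : Fin 3 → VField M} {p : M} {b : Covectors p}
  {T : Matrix (Fin 3) (Fin 3) ℝ}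

/-- The coframe field `A θ`, where `A` is the constant matrix `groupMatrix φ x y z`. -/
def transformField (φ x y z : ℝ) (θ : Fin 3 → OneForm M) : Fin 3 → OneForm M :=
  fun i q ↦ transform φ x y z (fun j ↦ θ j q) i

theorem smoothOn_transformField (φ x y z : ℝ) (hθ : ∀ i, (θ i).SmoothOn U) (i : Fin 3) :
    (transformField φ x y z θ i).SmoothOn U := by
  have hc : ∀ c : ℝ, FunSmoothOn (fun _ : M ↦ c) U := FunSmoothOn.const
  fin_cases i
  · have : transformField φ x y z θ 0 =
        fun q ↦ (Real.cos φ • θ 0 q + (-Real.sin φ) • θ 1 q) + x • θ 2 q := by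
      funext q
      ext v
      simp [transformField, transform, sub_eq_add_neg]
    change (transformField φ x y z θ 0).SmoothOn U
    rw [this]
    exact (((hθ 0).smul (hc _)).add ((hθ 1).smul (hc _))).add ((hθ 2).smul (hc _))
  · exact (((hθ 0).smul (hc _)).add ((hθ 1).smul (hc _))).add ((hθ 2).smul (hc _))
  · exact (hθ 2).smul (hc _)

theorem IsSection.exists_hasTorsion {B : ∀ p : M, Set (Covectors p)} (hη : IsSection B U η)
    (hB : ∀ q, ∀ b ∈ B q, LinearIndependent ℝ b) {𝔤 : Set (Matrix (Fin 3) (Fin 3) ℝ)}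
    (h0 : 0 ∈ 𝔤) (hp : p ∈ U) : ∃ T, HasTorsion 𝔤 B (fun i ↦ η i p) T := by
  obtain ⟨X, hX⟩ := exists_isDualOn hη.isOpen hη.smooth fun q hq ↦ hB q _ (hη.mem q hq)
  exact ⟨_, U, η, _, _, hp, hη, rfl, hX.structureEquations h0, rfl⟩

theorem IsReference.mem_B₀_iff (h : IsReference S U θ X) (hp : p ∈ U) (b : Covectors p) :
    b ∈ S.B₀ p ↔ ∃ φ x y z : ℝ, z ≠ 0 ∧ b = transform φ x y z (fun i ↦ θ i p) :=
  (h.adapted p hp).mem_B₀_iff (h.dual p hp) b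

theorem IsReference.isSection_transformField (h : IsReference S U θ X) (φ x y : ℝ) {z : ℝ}
    (hz : z ≠ 0) : IsSection S.B₀ U (transformField φ x y z θ) :=
  ⟨h.isOpen, smoothOn_transformField φ x y z h.smooth,
    fun _ hq ↦ (h.mem_B₀_iff hq _).2 ⟨φ, x, y, z, hz, rfl⟩⟩

theorem IsReference.two_apply_of_mem_B₀ (h : IsReference S U θ X) (hp : p ∈ U)
    (hb : b ∈ S.B₀ p) : b 2 (X 0 p) = 0 ∧ b 2 (X 1 p) = 0 := by
  obtain ⟨f, -, h0, h1, -⟩ := h.adapted p hp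
  have h0 : (f 0 : TangentSpace 𝓘(ℝ, R3) p) = X 0 p := h0
  have h1 : (f 1 : TangentSpace 𝓘(ℝ, R3) p) = X 1 p := h1
  rw [← h0, ← h1]
  exact ⟨hb.2.2.1 _, hb.2.2.1 _⟩

theorem IsReference.exists_hasTorsion_B₀ (h : IsReference S U θ X) (hp : p ∈ U)
    (hb : b ∈ S.B₀ p) : ∃ T, HasTorsion 𝔤₀ S.B₀ b T := by
  obtain ⟨φ, x, y, z, hz, rfl⟩ := (h.mem_B₀_iff hp b).1 hb
  exact (h.isSection_transformField φ x y hz).exists_hasTorsion (fun _ _ hb ↦ hb.1) zero_mem_𝔤₀ hp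

/-- The third form of the section vanishes on X₁ and X₂ near `p`, so no derivatives survive, and
dθ³(X₁, X₂) = 1. -/
theorem IsReference.d_apply_of_isSection_B₀ (h : IsReference S U θ X) (hη : IsSection S.B₀ V η)
    (hp : p ∈ U) (hpV : p ∈ V) : (η 2).d p (X 0 p) (X 1 p) = η 2 p (X 2 p) := by
  have hW := h.mono (h.isOpen.inter hη.isOpen) Set.inter_subset_left
  have hk := fun q (hq : q ∈ U ∩ V) ↦ h.two_apply_of_mem_B₀ hq.1 (hη.mem q hq.2)
  rw [hW.d_apply ((hη.smooth 2).mono Set.inter_subset_right) ⟨hp, hpV⟩,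
    differential_eq_zero hW.isOpen ⟨hp, hpV⟩ (fun q hq ↦ (hk q hq).2),
    differential_eq_zero hW.isOpen ⟨hp, hpV⟩ (fun q hq ↦ (hk q hq).1), Fin.sum_univ_three,
    (hk p ⟨hp, hpV⟩).1, (hk p ⟨hp, hpV⟩).2, h.d_two p hp]
  have hd := h.dual p hp
  simp [wedge, hd 0 0, hd 0 1, hd 1 0, hd 1 1]

/-- On X₁, X₂ the connection drops out: its third row is (0, 0, *) and η³ vanishes on the plane. The
area form η¹ ∧ η² takes the value 1 there, because the block is a rotation. -/
theorem IsReference.torsion_B₀ (h : IsReference S U θ X) (hp : p ∈ U)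
    (hT : HasTorsion 𝔤₀ S.B₀ b T) : T 2 2 = b 2 (X 2 p) := by
  obtain ⟨V, η, c, τ, hpV, hη, rfl, hs, rfl⟩ := hT
  have he := hs.equation p hpV (X 0 p) (X 1 p) 2
  obtain ⟨k0, k1⟩ := h.two_apply_of_mem_B₀ hp (hη.mem p hpV)
  rw [h.d_apply_of_isSection_B₀ hη hp hpV, Fin.sum_univ_three] at he
  obtain ⟨φ, x, y, z, hz, hb⟩ := (h.mem_B₀_iff hp _).1 (hη.mem p hpV)
  have c0 : ∀ v, c 2 0 p v = 0 := fun v ↦ by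
    obtain ⟨_, _, _, _, e⟩ := hs.connection_mem p hpV v
    simpa using congrFun (congrFun e 2) 0
  have c1 : ∀ v, c 2 1 p v = 0 := fun v ↦ by
    obtain ⟨_, _, _, _, e⟩ := hs.connection_mem p hpV v
    simpa using congrFun (congrFun e 2) 1
  have b0 : η 0 p = _ := congrFun hb 0
  have b1 : η 1 p = _ := congrFun hb 1
  have hd := h.dual p hp
  have hw : wedge (η 0 p) (η 1 p) (X 0 p) (X 1 p) = 1 := by
    simp [b0, b1, transform, wedge, hd 0 0, hd 0 1, hd 1 0, hd 1 1, hd 2 0, hd 2 1]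
    linear_combination Real.sin_sq_add_cos_sq φ
  rw [hw] at he
  simp only [wedge, c0, c1, k0, k1] at he
  linarith

theorem IsReference.mem_B₁_iff (h : IsReference S U θ X) (hp : p ∈ U) (b : Covectors p) :
    b ∈ S.B₁ p ↔ ∃ φ x y : ℝ, b = transform φ x y 1 (fun i ↦ θ i p) := by
  have hd : ∀ φ x y z, transform φ x y z (fun i ↦ θ i p) 2 (X 2 p) = z := fun φ x y z ↦ by
    simp [transform, h.dual p hp 2 2]
  constructor
  · rintro ⟨hb, T, hT, h1⟩
    rw [h.torsion_B₀ hp hT] at h1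
    obtain ⟨φ, x, y, z, hz, rfl⟩ := (h.mem_B₀_iff hp b).1 hb
    rw [hd] at h1
    exact ⟨φ, x, y, by rw [h1]⟩
  · rintro ⟨φ, x, y, rfl⟩
    have hb := (h.mem_B₀_iff hp _).2 ⟨φ, x, y, 1, one_ne_zero, rfl⟩
    obtain ⟨T, hT⟩ := h.exists_hasTorsion_B₀ hp hb
    exact ⟨hb, T, hT, (h.torsion_B₀ hp hT).trans (hd φ x y 1)⟩

theorem IsReference.isSection_B₁ (h : IsReference S U θ X) (φ x y : ℝ) :
    IsSection S.B₁ U (transformField φ x y 1 θ) :=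
  ⟨h.isOpen, smoothOn_transformField φ x y 1 h.smooth,
    fun _ hq ↦ (h.mem_B₁_iff hq _).2 ⟨φ, x, y, rfl⟩⟩

theorem IsReference.exists_hasTorsion_B₁ (h : IsReference S U θ X) (hp : p ∈ U)
    (hb : b ∈ S.B₁ p) : ∃ T, HasTorsion 𝔤₁ S.B₁ b T := by
  obtain ⟨φ, x, y, rfl⟩ := (h.mem_B₁_iff hp b).1 hb
  exact (h.isSection_B₁ φ x y).exists_hasTorsion (fun _ _ hb ↦ hb.1.1) zero_mem_𝔤₁ hp

theorem IsReference.two_eq_of_mem_B₁ (h : IsReference S U θ X) (hp : p ∈ U) (hb : b ∈ S.B₁ p) :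
    b 2 = θ 2 p := by
  obtain ⟨φ, x, y, rfl⟩ := (h.mem_B₁_iff hp b).1 hb
  simp [transform]

theorem IsReference.d_two_of_isSection_B₁ (h : IsReference S U θ X) (hη : IsSection S.B₁ V η)
    (hp : p ∈ U) (hpV : p ∈ V) (u v : TangentSpace 𝓘(ℝ, R3) p) :
    (η 2).d p u v = wedge (θ 0 p) (θ 1 p) u v := by
  rw [← h.d_two p hp]
  apply OneForm.d_congr
  filter_upwards [h.isOpen.mem_nhds hp, hη.isOpen.mem_nhds hpV] with q hq hq'
  exact h.two_eq_of_mem_B₁ hq (hη.mem q hq')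

/-- The third row of the connection is zero and η³ = θ³ near `p`, so the third row of the torsion
consists of the coefficients of θ¹ ∧ θ² = (b¹ − x b³) ∧ (b² − y b³). -/
theorem IsReference.torsion_B₁ (h : IsReference S U θ X) (hp : p ∈ U) {φ x y : ℝ}
    (hT : HasTorsion 𝔤₁ S.B₁ (transform φ x y 1 (fun i ↦ θ i p)) T) :
    T 2 0 = x ∧ T 2 1 = y ∧ T 2 2 = 1 := by
  obtain ⟨V, η, c, τ, hpV, hη, hb, hs, rfl⟩ := hT
  have c0 : ∀ i v, c 2 i p v = 0 := fun i v ↦ by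
    obtain ⟨_, _, _, e⟩ := hs.connection_mem p hpV v
    have := congrFun (congrFun e 2) i
    fin_cases i <;> simpa using this
  have b0 : η 0 p = _ := congrFun hb 0
  have b1 : η 1 p = _ := congrFun hb 1
  have b2 : η 2 p = _ := congrFun hb 2
  have he : ∀ k l : Fin 3, _ := fun k l ↦
    (h.d_two_of_isSection_B₁ hη hp hpV (X k p) (X l p)).symm.trans
    (hs.equation p hpV (X k p) (X l p) 2)
  have e01 := he 0 1
  have e02 := he 0 2
  have e12 := he 1 2
  have hd := h.dual p hp
  simp [b0, b1, b2, c0, transform, wedge, hd 0 _, hd 1 _, hd 2 _] at e01 e02 e12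
  have hcs := Real.sin_sq_add_cos_sq φ
  have h22 : τ p 2 2 = 1 := by linear_combination -e01 - τ p 2 2 * hcs
  rw [h22] at e02 e12
  refine ⟨?_, ?_, h22⟩
  · linear_combination (-Real.sin φ) * e02 - Real.cos φ * e12 - (τ p 2 0 - x) * hcs
  · linear_combination Real.cos φ * e02 - Real.sin φ * e12 - (τ p 2 1 - y) * hcs

theorem IsReference.mem_B₂_iff (h : IsReference S U θ X) (hp : p ∈ U) (b : Covectors p) :
    b ∈ S.B₂ p ↔ ∃ φ : ℝ, b = transform φ 0 0 1 (fun i ↦ θ i p) := by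
  constructor
  · rintro ⟨hb, T, hT, h1, h2⟩
    obtain ⟨φ, x, y, rfl⟩ := (h.mem_B₁_iff hp b).1 hb
    obtain ⟨e1, e2, -⟩ := h.torsion_B₁ hp hT
    exact ⟨φ, by rw [← e1, ← e2, h1, h2]⟩
  · rintro ⟨φ, rfl⟩
    have hb := (h.mem_B₁_iff hp _).2 ⟨φ, 0, 0, rfl⟩
    obtain ⟨T, hT⟩ := h.exists_hasTorsion_B₁ hp hb
    obtain ⟨e1, e2, -⟩ := h.torsion_B₁ hp hT
    exact ⟨hb, T, hT, e1, e2⟩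

theorem IsReference.isSection_B₂ (h : IsReference S U θ X) (φ : ℝ) :
    IsSection S.B₂ U (transformField φ 0 0 1 θ) :=
  ⟨h.isOpen, smoothOn_transformField φ 0 0 1 h.smooth,
    fun _ hq ↦ (h.mem_B₂_iff hq _).2 ⟨φ, rfl⟩⟩

omit [IsManifold 𝓘(ℝ, R3) ∞ M] in
theorem transformField_zero : transformField 0 0 0 1 θ = θ := by
  funext i q
  exact congrFun (transform_zero _) i

theorem IsReference.linearIndependent (h : IsReference S U θ X) (hp : p ∈ U) :
    LinearIndependent ℝ (fun i ↦ θ i p) := (h.dual p hp).linearIndependent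

variable (S)

theorem isGStructure_B₀ : IsGStructure S.B₀ G₀ := isGStructure_of_orbit fun p ↦ by
  obtain ⟨U, θ, X, hp, h⟩ := exists_isReference S p
  refine ⟨U, θ, hp, ?_, h.linearIndependent hp, fun b ↦ ?_⟩
  · rw [← transformField_zero (θ := θ)]
    exact h.isSection_transformField 0 0 0 one_ne_zero
  · rw [exists_act_G₀_iff, h.mem_B₀_iff hp]

theorem isGStructure_B₁ : IsGStructure S.B₁ G₁ := isGStructure_of_orbit fun p ↦ by
  obtain ⟨U, θ, X, hp, h⟩ := exists_isReference S p
  refine ⟨U, θ, hp, ?_, h.linearIndependent hp, fun b ↦ ?_⟩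
  · rw [← transformField_zero (θ := θ)]
    exact h.isSection_B₁ 0 0 0
  · rw [exists_act_G₁_iff, h.mem_B₁_iff hp]

theorem isGStructure_B₂ : IsGStructure S.B₂ G₂ := isGStructure_of_orbit fun p ↦ by
  obtain ⟨U, θ, X, hp, h⟩ := exists_isReference S p
  refine ⟨U, θ, hp, ?_, h.linearIndependent hp, fun b ↦ ?_⟩
  · rw [← transformField_zero (θ := θ)]
    exact h.isSection_B₂ 0
  · rw [exists_act_G₂_iff, h.mem_B₂_iff hp]

theorem exists_torsion_B₀ (hb : b ∈ S.B₀ p) : ∃ t : ℝ, t ≠ 0 ∧ (∃ T, HasTorsion 𝔤₀ S.B₀ b T) ∧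
    (∀ T, HasTorsion 𝔤₀ S.B₀ b T → T 2 2 = t) ∧
    ∀ g ∈ G₀, ∀ T, HasTorsion 𝔤₀ S.B₀ (act g b) T →
      T 2 2 = ((g : Matrix (Fin 3) (Fin 3) ℝ) 2 2)⁻¹ * t := by
  obtain ⟨U, θ, X, hp, h⟩ := exists_isReference S p
  refine ⟨b 2 (X 2 p), ?_, h.exists_hasTorsion_B₀ hp hb, fun T hT ↦ h.torsion_B₀ hp hT, ?_⟩
  · obtain ⟨φ, x, y, z, hz, rfl⟩ := (h.mem_B₀_iff hp b).1 hb
    simpa [transform, h.dual p hp 2 2] using hz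
  · rintro g ⟨φ, x, y, z, hz, hg⟩ T hT
    rw [h.torsion_B₀ hp hT, act_eq_transform (groupMatrix_inv g φ x y z hz hg), hg]
    simp [transform, groupMatrix]

theorem exists_torsion_B₁ (hb : b ∈ S.B₁ p) : ∃ t₁ t₂ : ℝ, (∃ T, HasTorsion 𝔤₁ S.B₁ b T) ∧
    ∀ T, HasTorsion 𝔤₁ S.B₁ b T → T 2 0 = t₁ ∧ T 2 1 = t₂ ∧ T 2 2 = 1 := by
  obtain ⟨U, θ, X, hp, h⟩ := exists_isReference S p
  have hT := h.exists_hasTorsion_B₁ hp hb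
  obtain ⟨φ, x, y, rfl⟩ := (h.mem_B₁_iff hp b).1 hb
  exact ⟨x, y, hT, fun T hT ↦ h.torsion_B₁ hp hT⟩

end Bundles

/-! ### Normal coframes and the transition between them -/

section NormalCoframes

variable {M : Type*} [TopologicalSpace M] [ChartedSpace R3 M] [IsManifold 𝓘(ℝ, R3) ∞ M]
  {U V : Set M} {S : SubRiemannianSurface M} {η ζ θ : Fin 3 → OneForm M} {X Y : Fin 3 → VField M}
  {p : M}

/-- A coframe field `η` on `U` with dual frame `X`, which is adapted to `S` up to orientation and
satisfies `dη³ = η¹ ∧ η²`. -/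
structure IsNormalCoframe (S : SubRiemannianSurface M) (U : Set M) (η : Fin 3 → OneForm M)
    (X : Fin 3 → VField M) : Prop extends IsDualOn U η X where
  mem_iff : ∀ q ∈ U, ∀ v, v ∈ S.Δ q ↔ η 2 q v = 0
  metric : ∀ q ∈ U, ∀ w : S.Δ q, S.metric q w w = η 0 q w ^ 2 + η 1 q w ^ 2
  d_two : ∀ q ∈ U, ∀ u v, (η 2).d q u v = wedge (η 0 q) (η 1 q) u v

theorem IsNormalCoframe.restrict (h : IsNormalCoframe S U η X) (hV : IsOpen V) (hVU : V ⊆ U) :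
    IsNormalCoframe S V η X :=
  ⟨h.mono hV hVU, fun q hq ↦ h.mem_iff q (hVU hq), fun q hq ↦ h.metric q (hVU hq),
    fun q hq ↦ h.d_two q (hVU hq)⟩

/-- The Jacobi identity for the frame dual to a coframe with `dη³ = η¹ ∧ η²`. -/
theorem IsDualOn.d_zero_eq_d_one (h : IsDualOn U η X)
    (hd : ∀ q ∈ U, ∀ u v, (η 2).d q u v = wedge (η 0 q) (η 1 q) u v) (hp : p ∈ U) :
    (η 0).d p (X 2 p) (X 0 p) = (η 1).d p (X 1 p) (X 2 p) := by
  have hman : IsManifold 𝓘(ℝ, R3) (minSmoothness ℝ 3) M :=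
    IsManifold.of_le (n := ∞) three_le_minSmoothness
  have hX : ∀ i, ContMDiffAt 𝓘(ℝ, R3) 𝓘(ℝ, R3).tangent (minSmoothness ℝ 2)
      (fun q ↦ (⟨q, X i q⟩ : TangentBundle 𝓘(ℝ, R3) M)) p := fun i ↦
    ((h.smooth_frame i p hp).contMDiffAt (h.isOpen.mem_nhds hp)).of_le two_le_minSmoothness
  have hl := leibniz_identity_mlieBracket_apply (hX 0) (hX 1) (hX 2)
  have hdual := fun q (hq : q ∈ U) ↦ h.dual q hq
  have hw : ∀ k l, ∀ q ∈ U, η 2 q (mlieBracket 𝓘(ℝ, R3) (X k) (X l) q) =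
      -wedge (η 0 q) (η 1 q) (X k q) (X l q) := fun k l q hq ↦ by
    rw [← hd q hq, h.d_self hq, neg_neg]
  have hbr : ∀ k l, VField.SmoothOn (mlieBracket 𝓘(ℝ, R3) (X k) (X l)) U := fun k l ↦
    (h.smooth_frame k).bracket h.isOpen (h.smooth_frame l)
  have e0 := (h.smooth 2).d_apply_vectorField h.isOpen (h.smooth_frame 0) (hbr 1 2) hp
  have e1 := (h.smooth 2).d_apply_vectorField h.isOpen (h.smooth_frame 1) (hbr 0 2) hp
  have e2 := (h.smooth 2).d_apply_vectorField h.isOpen (hbr 0 1) (h.smooth_frame 2) hp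
  -- On `U` the form η³ takes constant values on the frame and on its brackets, so Cartan's formula
  -- expresses η³ of each double bracket through η¹ ∧ η² alone.
  have z : ∀ j, differential (fun q ↦ η 2 q (X j q)) p = 0 := fun j ↦
    differential_eq_zero h.isOpen hp (fun q hq ↦ h.dual q hq 2 j)
  have z12 : differential (fun q ↦ η 2 q (mlieBracket 𝓘(ℝ, R3) (X 1) (X 2) q)) p = 0 :=
    differential_eq_zero h.isOpen hp (c := 0) fun q hq ↦ by
      simp [hw 1 2 q hq, wedge, hdual q hq _ _]
  have z02 : differential (fun q ↦ η 2 q (mlieBracket 𝓘(ℝ, R3) (X 0) (X 2) q)) p = 0 :=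
    differential_eq_zero h.isOpen hp (c := 0) fun q hq ↦ by
      simp [hw 0 2 q hq, wedge, hdual q hq _ _]
  have z01 : differential (fun q ↦ η 2 q (mlieBracket 𝓘(ℝ, R3) (X 0) (X 1) q)) p = 0 :=
    differential_eq_zero h.isOpen hp (c := -1) fun q hq ↦ by
      simp [hw 0 1 q hq, wedge, hdual q hq _ _]
  rw [z, z12, hd p hp] at e0
  rw [z, z02, hd p hp] at e1
  rw [z, z01, hd p hp] at e2
  have hl2 := congrArg (η 2 p) hl
  rw [map_add] at hl2
  simp [wedge, hdual p hp _ _] at e0 e1 e2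
  rw [(h.smooth 0).d_swap (h.isOpen.mem_nhds hp), h.d_self hp, h.d_self hp]
  linarith

/-- The coefficients `(a₁, a₂)` of the normal form of the torsion of `η`. -/
def normalCoefficients (η : Fin 3 → OneForm M) (X : Fin 3 → VField M) (p : M) : ℝ × ℝ :=
  ((1 / 2) * ((η 0).d p (X 1 p) (X 2 p) - (η 1).d p (X 2 p) (X 0 p)), (η 0).d p (X 2 p) (X 0 p))

theorem IsNormalCoframe.frame_mem (h : IsNormalCoframe S U η X) (hp : p ∈ U) :
    X 0 p ∈ S.Δ p ∧ X 1 p ∈ S.Δ p := by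
  rw [h.mem_iff p hp, h.mem_iff p hp, h.dual p hp 2 0, h.dual p hp 2 1]
  simp

/-- The transition matrix between two normal coframes, part one: it preserves the plane and the
scalar product. -/
theorem IsNormalCoframe.transition_orthogonal (h : IsNormalCoframe S U η X)
    (h' : IsNormalCoframe S U ζ Y) (hp : p ∈ U) :
    ζ 2 p (X 0 p) = 0 ∧ ζ 2 p (X 1 p) = 0 ∧
    ζ 0 p (X 0 p) * ζ 0 p (X 0 p) + ζ 1 p (X 0 p) * ζ 1 p (X 0 p) = 1 ∧
    ζ 0 p (X 1 p) * ζ 0 p (X 1 p) + ζ 1 p (X 1 p) * ζ 1 p (X 1 p) = 1 ∧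
    ζ 0 p (X 0 p) * ζ 0 p (X 1 p) + ζ 1 p (X 0 p) * ζ 1 p (X 1 p) = 0 := by
  obtain ⟨m0, m1⟩ := h.frame_mem hp
  -- Both coframes compute the same metric; it is evaluated on two basis vectors and their sum.
  have e : ∀ w : S.Δ p, η 0 p w ^ 2 + η 1 p w ^ 2 = ζ 0 p w ^ 2 + ζ 1 p w ^ 2 := fun w ↦
    (h.metric p hp w).symm.trans (h'.metric p hp w)
  have e0 := e ⟨X 0 p, m0⟩
  have e1 := e ⟨X 1 p, m1⟩
  have e2 := e (⟨X 0 p, m0⟩ + ⟨X 1 p, m1⟩)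
  have hd := h.dual p hp
  simp only [Submodule.coe_add, map_add, hd 0 0, hd 0 1, hd 1 0, hd 1 1] at e0 e1 e2
  simp at e0 e1 e2
  refine ⟨(h'.mem_iff p hp _).1 m0, (h'.mem_iff p hp _).1 m1, ?_, ?_, ?_⟩
  · linear_combination -e0
  · linear_combination -e1
  · linear_combination (e0 + e1 - e2) / 2

/-- The transition matrix between two normal coframes, part two: it is block diagonal, and the
lower right entry is the determinant of the upper left block. -/
theorem IsNormalCoframe.transition_block (h : IsNormalCoframe S U η X)
    (h' : IsNormalCoframe S U ζ Y) (hp : p ∈ U) :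
    ζ 2 p (X 2 p) = ζ 0 p (X 0 p) * ζ 1 p (X 1 p) - ζ 0 p (X 1 p) * ζ 1 p (X 0 p) ∧
    ζ 2 p (X 2 p) * ζ 2 p (X 2 p) = 1 ∧ ζ 0 p (X 2 p) = 0 ∧ ζ 1 p (X 2 p) = 0 := by
  -- Two evaluations of dζ³(X₁, X₂): through ζ³ as a multiple of η³, and through ζ¹ ∧ ζ².
  have e01 : ∀ q ∈ U, ζ 2 q (X 2 q) =
      ζ 0 q (X 0 q) * ζ 1 q (X 1 q) - ζ 0 q (X 1 q) * ζ 1 q (X 0 q) := by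
    intro q hq
    obtain ⟨k0, k1, -⟩ := h.transition_orthogonal h' hq
    have e := h.d_apply (h'.smooth 2) hq 0 1
    rw [h'.d_two q hq, differential_eq_zero h.isOpen hq
        (fun r hr ↦ (h.transition_orthogonal h' hr).1), differential_eq_zero h.isOpen hq
        (fun r hr ↦ (h.transition_orthogonal h' hr).2.1), Fin.sum_univ_three, k0, k1,
        h.d_two q hq] at e
    simp [wedge, h.dual q hq _ _] at e
    linarith
  have hsq : ∀ q ∈ U, ζ 2 q (X 2 q) * ζ 2 q (X 2 q) = 1 := by
    intro q hq
    obtain ⟨-, -, o1, o2, o3⟩ := h.transition_orthogonal h' hq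
    rw [e01 q hq]
    generalize ζ 0 q (X 0 q) = a00 at *
    generalize ζ 0 q (X 1 q) = a01 at *
    generalize ζ 1 q (X 0 q) = a10 at *
    generalize ζ 1 q (X 1 q) = a11 at *
    linear_combination (a01 * a01 + a11 * a11) * o1 + o2 - (a00 * a01 + a10 * a11) * o3
  have hsm : FunSmoothOn (fun q ↦ ζ 2 q (X 2 q)) U := (h'.smooth 2).apply (h.smooth_frame 2)
  have hne : ζ 2 p (X 2 p) ≠ 0 := fun h0 ↦ by simpa [h0] using hsq p hp
  -- The square of this function is constantly 1, so its differential vanishes.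
  have hdz : ∀ v, differential (fun q ↦ ζ 2 q (X 2 q)) p v = 0 := by
    intro v
    have e := differential_mul h.isOpen hp hsm hsm v
    rw [differential_eq_zero h.isOpen hp hsq] at e
    have : ζ 2 p (X 2 p) * differential (fun q ↦ ζ 2 q (X 2 q)) p v = 0 := by
      simp only [zero_apply] at e
      linarith
    exact (mul_eq_zero.1 this).resolve_left hne
  obtain ⟨k0, k1, o1, o2, o3⟩ := h.transition_orthogonal h' hp
  -- Now dζ³(Xₖ, X₃) = 0 for k = 1, 2. Through ζ¹ ∧ ζ² this is a homogeneous linear system for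
  -- ζ¹(X₃), ζ²(X₃) with nonzero determinant; Cramer's rule ends the argument.
  have f0 := h.d_apply (h'.smooth 2) hp 0 2
  have f1 := h.d_apply (h'.smooth 2) hp 1 2
  rw [h'.d_two p hp, hdz, differential_eq_zero h.isOpen hp
    (fun r hr ↦ (h.transition_orthogonal h' hr).1), Fin.sum_univ_three, k0, k1,
    h.d_two p hp] at f0
  rw [h'.d_two p hp, hdz, differential_eq_zero h.isOpen hp
    (fun r hr ↦ (h.transition_orthogonal h' hr).2.1), Fin.sum_univ_three, k0, k1,
    h.d_two p hp] at f1
  simp [wedge, h.dual p hp _ _] at f0 f1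
  have h01 := e01 p hp
  have hs := hsq p hp
  refine ⟨h01, hs, ?_, ?_⟩
  all_goals
    refine (mul_eq_zero.1 (?_ : ζ 2 p (X 2 p) * _ = 0)).resolve_left hne
    rw [h01]
  · linear_combination ζ 0 p (X 1 p) * f0 - ζ 0 p (X 0 p) * f1
  · linear_combination ζ 1 p (X 1 p) * f0 - ζ 1 p (X 0 p) * f1

/-- The transition law for the coefficients of the normal form. -/
theorem IsNormalCoframe.normalCoefficients_eq (h : IsNormalCoframe S U η X)
    (h' : IsNormalCoframe S U ζ Y) (hp : p ∈ U) :
    (normalCoefficients η X p).2 = ζ 2 p (X 2 p) *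
      ((normalCoefficients ζ Y p).2 * (ζ 0 p (X 0 p) ^ 2 - ζ 1 p (X 0 p) ^ 2)
        - 2 * (normalCoefficients ζ Y p).1 * ζ 0 p (X 0 p) * ζ 1 p (X 0 p)) ∧
    (normalCoefficients η X p).1 =
      2 * (normalCoefficients ζ Y p).2 * ζ 0 p (X 0 p) * ζ 1 p (X 0 p)
        + (normalCoefficients ζ Y p).1 * (ζ 0 p (X 0 p) ^ 2 - ζ 1 p (X 0 p) ^ 2) := by
  have hA : ∀ i j, FunSmoothOn (fun q ↦ ζ i q (X j q)) U := fun i j ↦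
    (h'.smooth i).apply (h.smooth_frame j)
  -- The orthogonality relations, differentiated along X₃: the derivative of the block contributes
  -- antisymmetrically.
  have hsum : ∀ j k (c : ℝ), (∀ q ∈ U, ζ 0 q (X j q) * ζ 0 q (X k q)
      + ζ 1 q (X j q) * ζ 1 q (X k q) = c) →
      ζ 0 p (X j p) * differential (fun q ↦ ζ 0 q (X k q)) p (X 2 p)
      + ζ 0 p (X k p) * differential (fun q ↦ ζ 0 q (X j q)) p (X 2 p)
      + (ζ 1 p (X j p) * differential (fun q ↦ ζ 1 q (X k q)) p (X 2 p)
      + ζ 1 p (X k p) * differential (fun q ↦ ζ 1 q (X j q)) p (X 2 p)) = 0 := by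
    intro j k c hc
    rw [← differential_mul h.isOpen hp (hA 0 j) (hA 0 k),
      ← differential_mul h.isOpen hp (hA 1 j) (hA 1 k),
      ← differential_add h.isOpen hp ((hA 0 j).mul (hA 0 k)) ((hA 1 j).mul (hA 1 k)),
      differential_eq_zero h.isOpen hp hc, zero_apply]
  have d00 := hsum 0 0 1 fun q hq ↦ (h.transition_orthogonal h' hq).2.2.1
  have d01 := hsum 0 1 0 fun q hq ↦ (h.transition_orthogonal h' hq).2.2.2.2
  obtain ⟨k0, k1, o1, o2, o3⟩ := h.transition_orthogonal h' hp
  obtain ⟨hh, hs, z0, z1⟩ := h.transition_block h' hp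
  have hU := h.isOpen.mem_nhds hp
  have hz0 : differential (fun q ↦ ζ 0 q (X 2 q)) p = 0 :=
    differential_eq_zero h.isOpen hp fun r hr ↦ (h.transition_block h' hr).2.2.1
  have hz1 : differential (fun q ↦ ζ 1 q (X 2 q)) p = 0 :=
    differential_eq_zero h.isOpen hp fun r hr ↦ (h.transition_block h' hr).2.2.2
  -- dζⁱ(X₃, Xₖ) in two ways: expanded in the forms ζ, and by Cartan's formula in the frame `X`.
  have key : ∀ i k, _ := fun i k ↦
    ((h'.dual p hp).d_expand (h'.smooth i) hU (X 2 p) (X k p)).symm.trans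
    (h.d_apply (h'.smooth i) hp 2 k)
  have e00 := key 0 0
  have e01 := key 0 1
  have e10 := key 1 0
  have e11 := key 1 1
  have j := h.d_zero_eq_d_one h.d_two hp
  have j' := h'.d_zero_eq_d_one h'.d_two hp
  have s0 := (h.smooth 0).d_swap hU (X 2 p) (X 1 p)
  have s1 := (h.smooth 1).d_swap hU (X 2 p) (X 1 p)
  simp only [Fin.sum_univ_three, wedge, k0, k1, z0, z1, hz0, hz1, zero_apply, s0, s1, ← j, ← j']
    at e00 e01 e10 e11
  simp only [normalCoefficients]
  generalize differential (fun q ↦ ζ 0 q (X 0 q)) p (X 2 p) = D00 at *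
  generalize differential (fun q ↦ ζ 0 q (X 1 q)) p (X 2 p) = D01 at *
  generalize differential (fun q ↦ ζ 1 q (X 0 q)) p (X 2 p) = D10 at *
  generalize differential (fun q ↦ ζ 1 q (X 1 q)) p (X 2 p) = D11 at *
  generalize ζ 0 p (X 0 p) = a00 at *
  generalize ζ 0 p (X 1 p) = a01 at *
  generalize ζ 1 p (X 0 p) = a10 at *
  generalize ζ 1 p (X 1 p) = a11 at *
  generalize ζ 2 p (X 2 p) = t at *
  generalize (η 0).d p (X 2 p) (X 0 p) = r0 at *
  generalize (η 1).d p (X 2 p) (X 0 p) = r1 at *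
  generalize (η 0).d p (X 1 p) (X 2 p) = p0 at *
  generalize (ζ 0).d p (Y 2 p) (Y 0 p) = R0 at *
  generalize (ζ 1).d p (Y 2 p) (Y 0 p) = R1 at *
  generalize (ζ 0).d p (Y 1 p) (Y 2 p) = P0 at *
  -- An orthogonal block of determinant `t` is determined by its first column.
  have h11 : a11 = t * a00 := by linear_combination a00 * (-hh) + a10 * o3 - a11 * o1
  have h10 : a01 = -t * a10 := by linear_combination a10 * hh + a00 * o3 - a01 * o1
  have hF : t * (R0 * (2 * a00 * a01 - 2 * a10 * a11) - (P0 - R1) * (a00 * a11 + a10 * a01)) =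
      -2 * (2 * R0 * a00 * a10 + 1 / 2 * (P0 - R1) * (a00 ^ 2 - a10 ^ 2)) := by
    rw [h11, h10]
    linear_combination -2 * (2 * R0 * a00 * a10 + 1 / 2 * (P0 - R1) * (a00 ^ 2 - a10 ^ 2)) * hs
  refine ⟨?_, ?_⟩
  -- Contraction with the block, symmetrised in both goals: the derivative terms cancel by `d00` and
  -- `d01`.
  · linear_combination -(a00 * e00 + a10 * e10) - d00 / 2 - r0 * o1 - r1 * o3
  · linear_combination (1 / 2) * (a01 * e00 + a11 * e10 + a00 * e01 + a10 * e11) + d01 / 2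
      + r1 / 2 * o2 - p0 / 2 * o1 - hF / 2

/-- The invariant does not depend on the normal coframe. -/
theorem IsNormalCoframe.invariant_eq (h : IsNormalCoframe S U η X)
    (h' : IsNormalCoframe S V ζ Y) (hp : p ∈ U) (hpV : p ∈ V) :
    (normalCoefficients η X p).1 ^ 2 + (normalCoefficients η X p).2 ^ 2 =
      (normalCoefficients ζ Y p).1 ^ 2 + (normalCoefficients ζ Y p).2 ^ 2 := by
  have hW := h.isOpen.inter h'.isOpen
  have hr := h.restrict hW Set.inter_subset_left
  have hr' := h'.restrict hW Set.inter_subset_right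
  obtain ⟨e2, e1⟩ := hr.normalCoefficients_eq hr' ⟨hp, hpV⟩
  obtain ⟨-, -, o1, -⟩ := hr.transition_orthogonal hr' ⟨hp, hpV⟩
  obtain ⟨-, hs, -⟩ := hr.transition_block hr' ⟨hp, hpV⟩
  rw [e1, e2, mul_pow, pow_two (ζ 2 p (X 2 p)), hs]
  generalize ζ 0 p (X 0 p) = c at *
  generalize ζ 1 p (X 0 p) = s at *
  generalize (normalCoefficients ζ Y p).1 = u
  generalize (normalCoefficients ζ Y p).2 = v
  -- The pair is turned through the double angle: (c² − s²)² + (2cs)² = (c² + s²)² = 1.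
  linear_combination (u ^ 2 + v ^ 2) * (c * c + s * s + 1) * o1

/-- The transition law involves only the transition matrix at `p`, here the identity; how the
coframes differ elsewhere does not matter. -/
theorem IsNormalCoframe.normalCoefficients_congr (h : IsNormalCoframe S U η X)
    (h' : IsNormalCoframe S V ζ Y) (hp : p ∈ U) (hpV : p ∈ V)
    (he : (fun i ↦ η i p) = fun i ↦ ζ i p) :
    normalCoefficients η X p = normalCoefficients ζ Y p := by
  have hW := h.isOpen.inter h'.isOpen
  have hr := h.restrict hW Set.inter_subset_left
  have hr' := h'.restrict hW Set.inter_subset_right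
  obtain ⟨e2, e1⟩ := hr.normalCoefficients_eq hr' ⟨hp, hpV⟩
  have hd : ∀ i j, ζ i p (X j p) = if i = j then 1 else 0 := fun i j ↦ by
    rw [← h.dual p hp i j]
    exact (DFunLike.congr_fun (congrFun he i) _).symm
  rw [hd 0 0, hd 1 0, hd 2 2] at e2
  rw [hd 0 0, hd 1 0] at e1
  simp at e1 e2
  exact Prod.ext e1 e2

theorem IsReference.mem_Δ_iff (h : IsReference S U θ X) (hp : p ∈ U)
    (v : TangentSpace 𝓘(ℝ, R3) p) : v ∈ S.Δ p ↔ θ 2 p v = 0 := by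
  have hd := h.dual p hp
  refine ⟨fun hv ↦ ((h.adapted p hp).mem_B₀ hd).2.2.1 ⟨v, hv⟩, fun hv ↦ ?_⟩
  obtain ⟨f, -, h0, h1, -⟩ := h.adapted p hp
  have e := hd.expand_vec v
  rw [Fin.sum_univ_three, hv, zero_smul, add_zero] at e
  rw [e]
  have h0 : (f 0 : TangentSpace 𝓘(ℝ, R3) p) = X 0 p := h0
  have h1 : (f 1 : TangentSpace 𝓘(ℝ, R3) p) = X 1 p := h1
  rw [← h0, ← h1]
  exact Submodule.add_mem _ (Submodule.smul_mem _ _ (f 0).2) (Submodule.smul_mem _ _ (f 1).2)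

/-- Sections of `B₂` are normal coframes. -/
theorem IsSection.exists_isNormalCoframe (h : IsSection S.B₂ U η) :
    ∃ X, IsNormalCoframe S U η X := by
  have hB₀ : ∀ q ∈ U, (fun i ↦ η i q) ∈ S.B₀ q := fun q hq ↦ (h.mem q hq).1.1
  obtain ⟨X, hX⟩ := exists_isDualOn h.isOpen h.smooth fun q hq ↦ (hB₀ q hq).1
  have hB₁ : IsSection S.B₁ U η := ⟨h.isOpen, h.smooth, fun q hq ↦ (h.mem q hq).1⟩
  refine ⟨X, hX, fun q hq v ↦ ?_, fun q hq ↦ (hB₀ q hq).2.2.2, fun q hq u v ↦ ?_⟩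
  all_goals obtain ⟨V, θ, Z, hqV, hr⟩ := exists_isReference S q
  · rw [hr.mem_Δ_iff hqV, ← hr.two_eq_of_mem_B₁ hqV (hB₁.mem q hq)]
  · rw [hr.d_two_of_isSection_B₁ hB₁ hqV hq]
    obtain ⟨φ, hφ⟩ := (hr.mem_B₂_iff hqV _).1 (h.mem q hq)
    have b0 : η 0 q = _ := congrFun hφ 0
    have b1 : η 1 q = _ := congrFun hφ 1
    simp [b0, b1, transform, wedge]
    linear_combination (-(θ 0 q u * θ 1 q v - θ 0 q v * θ 1 q u)) * Real.sin_sq_add_cos_sq φ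

/-- The connection enters dη¹(X₂, X₃) and dη²(X₃, X₁) through the same term −α(X₃), which cancels in
their difference, and does not enter dη¹(X₃, X₁). So the coefficients are read off dη alone. -/
theorem SubRiemannianSurface.HasNormalTorsion.exists_isNormalCoframe {b : Covectors p} {a : ℝ × ℝ}
    (h : S.HasNormalTorsion b a) : ∃ U η X, p ∈ U ∧ IsNormalCoframe S U η X ∧
      (fun i ↦ η i p) = b ∧ a = normalCoefficients η X p := by
  obtain ⟨U, η, c, τ, hp, hη, hb, hs, hT⟩ := h
  obtain ⟨X, hX⟩ := hη.exists_isNormalCoframe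
  refine ⟨U, η, X, hp, hX, hb, ?_⟩
  obtain ⟨e1, e2, -⟩ := hs.d_eq hp (hX.dual p hp) 0
  obtain ⟨-, f2, -⟩ := hs.d_eq hp (hX.dual p hp) 1
  have hc : ∀ v, c 0 2 p v = 0 ∧ c 1 2 p v = 0 ∧ c 0 0 p v = 0 ∧ c 1 0 p v = -c 0 1 p v := by
    intro v
    obtain ⟨α, e⟩ := hs.connection_mem p hp v
    have g := fun i j ↦ congrFun (congrFun e i) j
    have g02 := g 0 2
    have g12 := g 1 2
    have g00 := g 0 0
    have g10 := g 1 0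
    have g01 := g 0 1
    simp at g02 g12 g00 g10 g01
    exact ⟨g02, g12, g00, by rw [g10, g01]⟩
  simp only [hT, normalForm, (hc _).1, (hc _).2.1, (hc _).2.2.1, (hc _).2.2.2] at e1 e2 f2
  simp at e1 e2 f2
  rw [normalCoefficients, e1, e2, f2]
  ext
  · ring
  · rfl

end NormalCoframes

/-! ### Normal form of the torsion and the invariant function -/

section Normalization

variable {M : Type*} [TopologicalSpace M] [ChartedSpace R3 M] [IsManifold 𝓘(ℝ, R3) ∞ M]
  {U : Set M} {S : SubRiemannianSurface M} {η θ : Fin 3 → OneForm M} {X : Fin 3 → VField M}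
  {p : M} {b : Covectors p}

theorem IsSection.exists_structureEquations (h : IsSection S.B₂ U η) :
    ∃ α T, StructureEquations 𝔤₂ U η (rotationForm α) T := by
  obtain ⟨X, hX⟩ := h.exists_isNormalCoframe
  refine ⟨0, torsionMatrix η X, ?_⟩
  have : rotationForm (0 : OneForm M) = fun _ _ ↦ 0 := by
    funext i j
    fin_cases i <;> fin_cases j
    all_goals first
      | rfl
      | exact neg_zero
  rw [this]
  exact hX.structureEquations zero_mem_𝔤₂

/-- The η¹ and η² parts of the correction absorb the column 12. The η³ part shifts T¹₂₃ and T²₃₁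
equally, hence removes their sum, and T¹₃₁ = T²₂₃ by the Jacobi identity. -/
theorem IsSection.structureEquations_normalForm (h : IsSection S.B₂ U η) {α : OneForm M}
    {T : M → Matrix (Fin 3) (Fin 3) ℝ} (hs : StructureEquations 𝔤₂ U η (rotationForm α) T) :
    StructureEquations 𝔤₂ U η
      (rotationForm fun p ↦ α p + T p 0 2 • η 0 p + T p 1 2 • η 1 p
        - ((1 / 2 : ℝ) * (T p 1 1 + T p 0 0)) • η 2 p)
      (fun p ↦ normalForm ((1 / 2 : ℝ) * (T p 0 0 - T p 1 1)) (T p 0 1)) := by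
  obtain ⟨X, hX⟩ := h.exists_isNormalCoframe
  have hc : ∀ c : ℝ, FunSmoothOn (fun _ : M ↦ c) U := FunSmoothOn.const
  have hT := hs.smooth_torsion
  have hα : α.SmoothOn U := hs.smooth_connection 0 1
  have hα' : OneForm.SmoothOn (fun p ↦ α p + T p 0 2 • η 0 p + T p 1 2 • η 1 p
      - ((1 / 2 : ℝ) * (T p 1 1 + T p 0 0)) • η 2 p) U :=
    ContMDiffOn.sub_section ((hα.add ((h.smooth 0).smul (hT 0 2))).add ((h.smooth 1).smul (hT 1 2)))
      ((h.smooth 2).smul ((hc _).mul ((hT 1 1).add (hT 0 0))))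
  refine ⟨fun i j ↦ ?_, fun i j ↦ ?_, fun q hq v ↦ ?_, fun q hq u v i ↦ ?_⟩
  · fin_cases i <;> fin_cases j
    all_goals first
      | exact OneForm.smoothOn_zero
      | exact hα'
      | exact ContMDiffOn.neg_section hα'
  · have h1 : FunSmoothOn (fun p ↦ (1 / 2 : ℝ) * (T p 0 0 - T p 1 1)) U :=
      (hc _).mul ((hT 0 0).sub (hT 1 1))
    fin_cases i <;> fin_cases j
    all_goals first
      | exact hc _
      | exact h1
      | exact hT 0 1
      | exact h1.neg
  · obtain ⟨r, hr⟩ : ∃ r, r = (α q + T q 0 2 • η 0 q + T q 1 2 • η 1 q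
      - ((1 / 2 : ℝ) * (T q 1 1 + T q 0 0)) • η 2 q) v := ⟨_, rfl⟩
    refine ⟨r, ?_⟩
    ext i j
    fin_cases i <;> fin_cases j
    all_goals first
      | rfl
      | exact hr.symm
      | exact congrArg Neg.neg hr.symm
  · have he := hs.equation q hq u v
    have hdual := hX.dual q hq
    have j := hX.d_zero_eq_d_one hX.d_two hq
    obtain ⟨-, e01, -⟩ := hs.d_eq hq hdual 0
    obtain ⟨e10, -, -⟩ := hs.d_eq hq hdual 1
    -- The connection entries in both coefficients are zero, so the Jacobi identity is one between
    -- torsions.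
    have j' : T q 0 1 = T q 1 0 := by
      rw [e01, e10] at j
      change (0 : ℝ) - 0 + _ = 0 - 0 + _ at j
      linarith
    have s0 : ∀ β : OneForm M, ∑ s, wedge (rotationForm β 0 s q) (η s q) u v =
        wedge (β q) (η 1 q) u v := fun β ↦ by
      rw [Fin.sum_univ_three]
      change wedge 0 (η 0 q) u v + wedge (β q) (η 1 q) u v + wedge 0 (η 2 q) u v = _
      simp only [wedge, zero_apply]
      ring
    have s1 : ∀ β : OneForm M, ∑ s, wedge (rotationForm β 1 s q) (η s q) u v =
        -wedge (β q) (η 0 q) u v := fun β ↦ by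
      rw [Fin.sum_univ_three]
      change wedge (-β q) (η 0 q) u v + wedge 0 (η 1 q) u v + wedge 0 (η 2 q) u v = _
      simp only [wedge, zero_apply, neg_apply]
      ring
    have s2 : ∀ β : OneForm M, ∑ s, wedge (rotationForm β 2 s q) (η s q) u v = 0 := fun β ↦ by
      rw [Fin.sum_univ_three]
      change wedge 0 (η 0 q) u v + wedge 0 (η 1 q) u v + wedge 0 (η 2 q) u v = _
      simp only [wedge, zero_apply]
      ring
    have e0 := he 0
    have e1 := he 1
    have e2 := hX.d_two q hq u v
    rw [s0] at e0
    rw [s1] at e1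
    obtain rfl | rfl | rfl : i = 0 ∨ i = 1 ∨ i = 2 := by fin_cases i <;> simp
    · rw [e0, s0]
      simp only [wedge, normalForm, Matrix.of_apply, Matrix.cons_val, add_apply, sub_apply,
        smul_apply, smul_eq_mul]
      ring
    · rw [e1, s1]
      simp only [wedge, normalForm, Matrix.of_apply, Matrix.cons_val, add_apply, sub_apply,
        smul_apply, smul_eq_mul, j']
      ring
    · rw [e2, s2]
      simp only [normalForm, Matrix.of_apply, Matrix.cons_val]
      ring

theorem existsUnique_hasNormalTorsion (hb : b ∈ S.B₂ p) :
    ∃! a : ℝ × ℝ, S.HasNormalTorsion b a := by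
  obtain ⟨U, θ, X, hp, h⟩ := exists_isReference S p
  obtain ⟨φ, rfl⟩ := (h.mem_B₂_iff hp b).1 hb
  have hη := h.isSection_B₂ φ
  obtain ⟨α, T, hs⟩ := hη.exists_structureEquations
  refine ⟨((1 / 2 : ℝ) * (T p 0 0 - T p 1 1), T p 0 1),
    ⟨U, _, _, _, hp, hη, rfl, hη.structureEquations_normalForm hs, rfl⟩, fun a ha ↦ ?_⟩
  have ha' : S.HasNormalTorsion (transform φ 0 0 1 (fun i ↦ θ i p))
      ((1 / 2 : ℝ) * (T p 0 0 - T p 1 1), T p 0 1) :=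
    ⟨U, _, _, _, hp, hη, rfl, hη.structureEquations_normalForm hs, rfl⟩
  obtain ⟨V, η, Y, hpV, hn, e, rfl⟩ := ha.exists_isNormalCoframe
  obtain ⟨V', η', Y', hpV', hn', e', h'⟩ := ha'.exists_isNormalCoframe
  rw [h']
  exact hn.normalCoefficients_congr hn' hpV hpV' (e.trans e'.symm)

theorem IsReference.isNormalCoframe (h : IsReference S U θ X) : IsNormalCoframe S U θ X :=
  ⟨h.toIsDualOn, fun _ hq ↦ h.mem_Δ_iff hq,
    fun q hq ↦ ((h.adapted q hq).mem_B₀ (h.dual q hq)).2.2.2, h.d_two⟩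

theorem exists_isNormalCoframe (S : SubRiemannianSurface M) (p : M) :
    ∃ s : Set M × (Fin 3 → OneForm M) × (Fin 3 → VField M),
      p ∈ s.1 ∧ IsNormalCoframe S s.1 s.2.1 s.2.2 := by
  obtain ⟨U, θ, X, hp, h⟩ := exists_isReference S p
  exact ⟨(U, θ, X), hp, h.isNormalCoframe⟩

/-- The invariant `a₁² + a₂²` as a function on `M`. -/
def SubRiemannianSurface.invariant (S : SubRiemannianSurface M) (p : M) : ℝ :=
  let s := (exists_isNormalCoframe S p).choose
  (normalCoefficients s.2.1 s.2.2 p).1 ^ 2 + (normalCoefficients s.2.1 s.2.2 p).2 ^ 2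

/-- Frees the invariant from the coframe chosen in its definition; smoothness and naturality then
follow from any convenient coframe. -/
theorem IsNormalCoframe.invariant (h : IsNormalCoframe S U η X) (hp : p ∈ U) :
    S.invariant p = (normalCoefficients η X p).1 ^ 2 + (normalCoefficients η X p).2 ^ 2 :=
  (exists_isNormalCoframe S p).choose_spec.2.invariant_eq h
    (exists_isNormalCoframe S p).choose_spec.1 hp

theorem SubRiemannianSurface.HasNormalTorsion.invariant {a : ℝ × ℝ} (h : S.HasNormalTorsion b a) :
    S.invariant p = a.1 ^ 2 + a.2 ^ 2 := by
  obtain ⟨U, η, X, hp, hn, -, rfl⟩ := h.exists_isNormalCoframe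
  exact hn.invariant hp

theorem SubRiemannianSurface.contMDiff_invariant (S : SubRiemannianSurface M) :
    ContMDiff 𝓘(ℝ, R3) 𝓘(ℝ, ℝ) ∞ S.invariant := by
  intro p
  obtain ⟨⟨U, η, X⟩, hp, h⟩ := exists_isNormalCoframe S p
  have h1 : FunSmoothOn (fun q ↦ (normalCoefficients η X q).1) U :=
    (FunSmoothOn.const _).mul ((h.smoothOn_d 0 1 2).sub (h.smoothOn_d 1 2 0))
  have h2 : FunSmoothOn (fun q ↦ (normalCoefficients η X q).2) U := h.smoothOn_d 0 2 0
  have h3 : FunSmoothOn S.invariant U := ((h1.mul h1).add (h2.mul h2)).congr fun q hq ↦ by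
    rw [h.invariant hq, pow_two, pow_two]
  exact (h3 p hp).contMDiffAt (h.isOpen.mem_nhds hp)

end Normalization

/-! ### Pullback along local equivalences -/

section Pullback

variable {M : Type*} [TopologicalSpace M] [ChartedSpace R3 M] [IsManifold 𝓘(ℝ, R3) ∞ M]
  {M' : Type*} [TopologicalSpace M'] [ChartedSpace R3 M'] [IsManifold 𝓘(ℝ, R3) ∞ M']
  {f : M → M'} {U : Set M} {U' : Set M'} {θ : Fin 3 → OneForm M'} {Y : Fin 3 → VField M'}
  {p : M}

omit [IsManifold 𝓘(ℝ, R3) ∞ M] [IsManifold 𝓘(ℝ, R3) ∞ M'] in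
theorem isInvertible_mfderiv (hf : IsLocalDiffeomorphAt 𝓘(ℝ, R3) 𝓘(ℝ, R3) ∞ f p) :
    (mfderiv 𝓘(ℝ, R3) 𝓘(ℝ, R3) f p).IsInvertible :=
  ⟨hf.mfderivToContinuousLinearEquiv (by simp), rfl⟩

/-- The pullback of a 1-form. -/
def OneForm.pullback (f : M → M') (α : OneForm M') : OneForm M :=
  fun q ↦ (α (f q)).comp (mfderiv 𝓘(ℝ, R3) 𝓘(ℝ, R3) f q)

omit [IsManifold 𝓘(ℝ, R3) ∞ M] [IsManifold 𝓘(ℝ, R3) ∞ M'] in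
theorem mfderiv_mpullback (hf : IsLocalDiffeomorphAt 𝓘(ℝ, R3) 𝓘(ℝ, R3) ∞ f p) (V : VField M') :
    mfderiv 𝓘(ℝ, R3) 𝓘(ℝ, R3) f p (mpullback 𝓘(ℝ, R3) 𝓘(ℝ, R3) f V p) = V (f p) := by
  rw [mpullback_apply]
  exact DFunLike.congr_fun (isInvertible_mfderiv hf).self_comp_inverse (V (f p))

/-- The pulled-back frame is smooth because the differential is invertible; smoothness of the forms
follows by duality. -/
theorem IsDualOn.pullback (h : IsDualOn U' θ Y) (hU : IsOpen U) (hUU' : ∀ q ∈ U, f q ∈ U')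
    (hf : ∀ q ∈ U, IsLocalDiffeomorphAt 𝓘(ℝ, R3) 𝓘(ℝ, R3) ∞ f q) :
    IsDualOn U (fun i ↦ (θ i).pullback f) (fun i ↦ mpullback 𝓘(ℝ, R3) 𝓘(ℝ, R3) f (Y i)) := by
  have hdual : ∀ q ∈ U, IsDual (fun i ↦ (θ i).pullback f q)
      (fun i ↦ mpullback 𝓘(ℝ, R3) 𝓘(ℝ, R3) f (Y i) q) := fun q hq i j ↦ by
    rw [← h.dual (f q) (hUU' q hq) i j]
    exact congrArg (θ i (f q)) (mfderiv_mpullback (hf q hq) (Y j))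
  have hman : IsManifold 𝓘(ℝ, R3) 1 M := IsManifold.of_le (n := ∞) (by simp)
  have hman' : IsManifold 𝓘(ℝ, R3) 1 M' := IsManifold.of_le (n := ∞) (by simp)
  have hX : ∀ i, VField.SmoothOn (mpullback 𝓘(ℝ, R3) 𝓘(ℝ, R3) f (Y i)) U := fun i q hq ↦
    (ContMDiffAt.mpullback_vectorField_preimage (m := ∞) (n := ∞)
      ((h.smooth_frame i _ (hUU' q hq)).contMDiffAt (h.isOpen.mem_nhds (hUU' q hq)))
      (hf q hq).contMDiffAt (isInvertible_mfderiv (hf q hq)) (by simp)).contMDiffWithinAt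
  exact ⟨hU, smoothOn_coframe_of_isDual hU hX hdual, hX, hdual⟩

/-- On a dual frame d is minus the pairing with a bracket, so naturality of d reduces to naturality
of the Lie bracket. -/
theorem IsDualOn.d_pullback (h : IsDualOn U' θ Y) (hU : IsOpen U) (hUU' : ∀ q ∈ U, f q ∈ U')
    (hf : ∀ q ∈ U, IsLocalDiffeomorphAt 𝓘(ℝ, R3) 𝓘(ℝ, R3) ∞ f q) (hp : p ∈ U) (i k l : Fin 3) :
    ((θ i).pullback f).d p (mpullback 𝓘(ℝ, R3) 𝓘(ℝ, R3) f (Y k) p)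
      (mpullback 𝓘(ℝ, R3) 𝓘(ℝ, R3) f (Y l) p) = (θ i).d (f p) (Y k (f p)) (Y l (f p)) := by
  have hman : IsManifold 𝓘(ℝ, R3) (minSmoothness ℝ 2) M :=
    IsManifold.of_le (n := ∞) two_le_minSmoothness
  have hman' : IsManifold 𝓘(ℝ, R3) (minSmoothness ℝ 2) M' :=
    IsManifold.of_le (n := ∞) two_le_minSmoothness
  have hY : ∀ j, MDifferentiableAt 𝓘(ℝ, R3) 𝓘(ℝ, R3).tangent
      (fun q ↦ (⟨q, Y j q⟩ : TangentBundle 𝓘(ℝ, R3) M')) (f p) := fun j ↦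
    ((h.smooth_frame j _ (hUU' p hp)).contMDiffAt
      (h.isOpen.mem_nhds (hUU' p hp))).mdifferentiableAt (by simp)
  rw [(h.pullback hU hUU' hf).d_self hp i k l, h.d_self (hUU' p hp),
    ← mpullback_mlieBracket (n := ∞) (hY k) (hY l) (hf p hp).contMDiffAt two_le_minSmoothness,
    ← mfderiv_mpullback (hf p hp) (mlieBracket 𝓘(ℝ, R3) (Y k) (Y l))]
  rfl

/-- The conditions on a normal coframe involve planes, metric and d but no orientation, so an
equivalence that reverses orientations still pulls it back. -/
theorem IsNormalCoframe.pullback {S : SubRiemannianSurface M} {S' : SubRiemannianSurface M'}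
    (h : IsNormalCoframe S' U' θ Y) (hU : IsOpen U) (hUU' : ∀ q ∈ U, f q ∈ U')
    (hf : ∀ q ∈ U, IsLocalEquivalenceAt S S' f q) :
    IsNormalCoframe S U (fun i ↦ (θ i).pullback f)
      (fun i ↦ mpullback 𝓘(ℝ, R3) 𝓘(ℝ, R3) f (Y i)) := by
  have hd := h.toIsDualOn.pullback hU hUU' fun q hq ↦ (hf q hq).1
  have hΔ : ∀ q ∈ U, ∀ v, v ∈ S.Δ q ↔ mfderiv 𝓘(ℝ, R3) 𝓘(ℝ, R3) f q v ∈ S'.Δ (f q) := by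
    intro q hq v
    rw [← ((hf q hq).2.self_of_nhds).1, Submodule.mem_map]
    refine ⟨fun hv ↦ ⟨v, hv, rfl⟩, ?_⟩
    rintro ⟨w, hw, e⟩
    have hinj : Function.Injective (mfderiv 𝓘(ℝ, R3) 𝓘(ℝ, R3) f q) :=
      ((hf q hq).1.mfderivToContinuousLinearEquiv (by simp)).injective
    rwa [← hinj e]
  refine ⟨hd, fun q hq v ↦ ?_, fun q hq w ↦ ?_, fun q hq u v ↦ ?_⟩
  · rw [hΔ q hq, h.mem_iff _ (hUU' q hq)]
    rfl
  · let w' : S'.Δ (f q) := ⟨mfderiv 𝓘(ℝ, R3) 𝓘(ℝ, R3) f q w, (hΔ q hq w).1 w.2⟩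
    rw [← ((hf q hq).2.self_of_nhds).2 w w w' w' rfl rfl, h.metric _ (hUU' q hq)]
    rfl
  · have e : ∀ k l, _ := fun k l ↦
      h.toIsDualOn.d_pullback hU hUU' (fun q hq ↦ (hf q hq).1) hq 2 k l
    rw [(hd.dual q hq).d_expand (hd.smooth 2) (hU.mem_nhds hq) u v]
    have h' := h.dual _ (hUU' q hq)
    rw [e, e, e, h.d_two _ (hUU' q hq), h.d_two _ (hUU' q hq), h.d_two _ (hUU' q hq)]
    have w12 : wedge (θ 0 (f q)) (θ 1 (f q)) (Y 1 (f q)) (Y 2 (f q)) = 0 := by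
      simp [wedge, h' _ _]
    have w20 : wedge (θ 0 (f q)) (θ 1 (f q)) (Y 2 (f q)) (Y 0 (f q)) = 0 := by
      simp [wedge, h' _ _]
    have w01 : wedge (θ 0 (f q)) (θ 1 (f q)) (Y 0 (f q)) (Y 1 (f q)) = 1 := by
      simp [wedge, h' _ _]
    rw [w12, w20, w01]
    ring

theorem IsLocalEquivalenceAt.eventually {S : SubRiemannianSurface M} {S' : SubRiemannianSurface M'}
    (hf : IsLocalEquivalenceAt S S' f p) : ∀ᶠ q in 𝓝 p, IsLocalEquivalenceAt S S' f q := by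
  obtain ⟨⟨Φ, hp, hΦ⟩, h⟩ := hf
  filter_upwards [Φ.open_source.mem_nhds hp, h.eventually_nhds] with q hq hq'
  exact ⟨⟨Φ, hq, hΦ⟩, hq'⟩

theorem IsLocalEquivalenceAt.invariant_eq {S : SubRiemannianSurface M}
    {S' : SubRiemannianSurface M'} (hf : IsLocalEquivalenceAt S S' f p) :
    S.invariant p = S'.invariant (f p) := by
  obtain ⟨⟨U', θ, Y⟩, hpU', h⟩ := exists_isNormalCoframe S' (f p)
  have hU' : ∀ᶠ q in 𝓝 p, f q ∈ U' :=
    hf.1.contMDiffAt.continuousAt.eventually (h.isOpen.mem_nhds hpU')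
  obtain ⟨U, hU, hUo, hpU⟩ := eventually_nhds_iff.1 (hU'.and hf.eventually)
  have hn := h.pullback hUo (fun q hq ↦ (hU q hq).1) fun q hq ↦ (hU q hq).2
  have e := h.toIsDualOn.d_pullback hUo (fun q hq ↦ (hU q hq).1) (fun q hq ↦ (hU q hq).2.1) hpU
  rw [hn.invariant hpU, h.invariant hpU']
  simp only [normalCoefficients, e]

end Pullback

end SubRiemannian

end

open SubRiemannian in
theorem mainTheorem2 {M : Type*} [TopologicalSpace M] [ChartedSpace R3 M]
    [IsManifold 𝓘(ℝ, R3) ∞ M] (S : SubRiemannianSurface M) :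
    -- the adapted coframes form a `G₀`-structure
    IsGStructure S.B₀ G₀ ∧
    -- `T³₁₂` is a well-defined nowhere vanishing function on `B₀`, multiplied by `φ₄⁻¹` under `G₀`
    (∀ (p : M), ∀ b ∈ S.B₀ p, ∃ t : ℝ, t ≠ 0 ∧ (∃ T, HasTorsion 𝔤₀ S.B₀ b T) ∧
      (∀ T, HasTorsion 𝔤₀ S.B₀ b T → T 2 2 = t) ∧
      ∀ g ∈ G₀, ∀ T, HasTorsion 𝔤₀ S.B₀ (act g b) T →
        T 2 2 = ((g : Matrix (Fin 3) (Fin 3) ℝ) 2 2)⁻¹ * t) ∧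
    -- normalising `T³₁₂ = 1` reduces the group to `G₁`
    IsGStructure S.B₁ G₁ ∧
    -- `T³₂₃` and `T³₃₁` are well-defined functions on `B₁`
    (∀ (p : M), ∀ b ∈ S.B₁ p, ∃ t₁ t₂ : ℝ, (∃ T, HasTorsion 𝔤₁ S.B₁ b T) ∧
      ∀ T, HasTorsion 𝔤₁ S.B₁ b T → T 2 0 = t₁ ∧ T 2 1 = t₂ ∧ T 2 2 = 1) ∧
    -- normalising `T³₂₃ = T³₃₁ = 0` reduces the group to `G₂`
    IsGStructure S.B₂ G₂ ∧
    -- every section of `B₂` satisfies structure equations, for some rotation-valued connection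
    (∀ U η, IsSection S.B₂ U η → ∃ α T, StructureEquations 𝔤₂ U η (rotationForm α) T) ∧
    -- modifying any such connection brings the torsion matrix to the normal form
    (∀ U η α T, IsSection S.B₂ U η → StructureEquations 𝔤₂ U η (rotationForm α) T →
      StructureEquations 𝔤₂ U η
        (rotationForm fun p ↦ α p + T p 0 2 • η 0 p + T p 1 2 • η 1 p
          - ((1 / 2 : ℝ) * (T p 1 1 + T p 0 0)) • η 2 p)
        (fun p ↦ normalForm ((1 / 2 : ℝ) * (T p 0 0 - T p 1 1)) (T p 0 1))) ∧
    -- `(a₁, a₂)` is a well-defined function on `B₂`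
    (∀ (p : M), ∀ b ∈ S.B₂ p, ∃! a : ℝ × ℝ, S.HasNormalTorsion b a) ∧
    -- `a₁² + a₂²` is invariant under `G₂`
    (∀ (p : M), ∀ b ∈ S.B₂ p, ∀ g ∈ G₂, ∀ a a' : ℝ × ℝ,
      S.HasNormalTorsion b a → S.HasNormalTorsion (act g b) a' →
      a'.1 ^ 2 + a'.2 ^ 2 = a.1 ^ 2 + a.2 ^ 2) ∧
    -- it descends to a smooth function on `M`, which is a differential invariant of `S`
    ∃ 𝓜 : M → ℝ, ContMDiff 𝓘(ℝ, R3) 𝓘(ℝ, ℝ) ∞ 𝓜 ∧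
      (∀ (p : M), ∀ b ∈ S.B₂ p, ∀ a : ℝ × ℝ,
        S.HasNormalTorsion b a → 𝓜 p = a.1 ^ 2 + a.2 ^ 2) ∧
      ∀ (M' : Type*) [TopologicalSpace M'] [ChartedSpace R3 M'] [IsManifold 𝓘(ℝ, R3) ∞ M']
        (S' : SubRiemannianSurface M') (f : M → M') (p : M), IsLocalEquivalenceAt S S' f p →
        ∀ b' ∈ S'.B₂ (f p), ∀ a' : ℝ × ℝ,
          S'.HasNormalTorsion b' a' → 𝓜 p = a'.1 ^ 2 + a'.2 ^ 2 := by
  refine ⟨isGStructure_B₀ S, fun p b hb ↦ exists_torsion_B₀ S hb, isGStructure_B₁ S,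
    fun p b hb ↦ exists_torsion_B₁ S hb, isGStructure_B₂ S,
    fun U η h ↦ h.exists_structureEquations, fun U η α T h hs ↦ h.structureEquations_normalForm hs,
    fun p b hb ↦ existsUnique_hasNormalTorsion hb, fun p b hb g hg a a' ha ha' ↦ ?_,
    S.invariant, S.contMDiff_invariant, fun p b hb a ha ↦ ha.invariant, ?_⟩
  · rw [← ha.invariant, ← ha'.invariant]
  · intro M' _ _ _ S' f p hf b' hb' a' ha'
    rw [hf.invariant_eq, ha'.invariant]
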